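/- Let $a=x_0<x_1<\dots<x_{N+1}=b$ be a partition of $(a,b)$, $h_j=x_j-x_{j-1}$, and for $1\le j\le N$ let $\tilde\phi_j:\mathbb R\to\mathbb R$ be the piecewise linear hat function, $\tilde\phi_j(x)=(x-x_{j-1})/h_j$ on $[x_{j-1},x_j]$, $\tilde\phi_j(x)=(x_{j+1}-x)/h_{j+1}$ on $(x_j,x_{j+1}]$, and $\tilde\phi_j=0$ elsewhere. Put $$\boldsymbol c_j=\Big(\tfrac1{h_j},-\tfrac1{h_j}-\tfrac1{h_{j+1}},\tfrac1{h_{j+1}}\Big),\qquad \boldsymbol D_j^k=\big(|x_{j+p}-x_{k+q}|\big)_{p,q\in\{-1,0,1\}},$$ and let functions act on $\boldsymbol D_j^k$ entry by entry. Let $\alpha\in(0,2)$, $$\rho_\infty(s)=\frac{C_\alpha}{s^{1+\alpha}},\qquad C_\alpha=\frac{2^{\alpha-1}\alpha\,\Gamma(\frac{1+\alpha}2)}{\sqrt\pi\,\Gamma(1-\frac\alpha2)},\qquad \rho_\delta=\rho_\infty\chi_{(0,\delta)},$$ and let $\boldsymbol S_\delta\in\mathbb R^{N\times N}$ be the nonlocal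 stiffness matrix $$(\boldsymbol S_\delta)_{jk}=\frac12\int_{\mathbb R}\int_{-\delta}^{\delta}\big(\tilde\phi_j(x+s)-\tilde\phi_j(x)\big)\big(\tilde\phi_k(x+s)-\tilde\phi_k(x)\big)\rho_\delta(|s|)\,ds\,dx .$$ Then for all $1\le j,k\le N$ the limit $(\boldsymbol S_\infty)_{jk}=\lim_{\delta\to\infty}(\boldsymbol S_\delta)_{jk}$ exists and $$(\boldsymbol S_\infty)_{jk}=\begin{cases}\dfrac{1}{2\Gamma(4-\alpha)\cos(\alpha\pi/2)}\,\boldsymbol c_j(\boldsymbol D_j^k)^{3-\alpha}\boldsymbol c_k^\top,&\alpha\ne1,\\[2mm]\dfrac1{2\pi}\,\boldsymbol c_j(\boldsymbol D_j^k)^2\ln(\boldsymbol D_j^k)\,\boldsymbol c_k^\top,&\alpha=1,\end{cases}$$ with the convention $0^2\ln0=0$. Moreover, with $g(z;s)=-\frac1{12}\big(|z+s|^3-2|z|^3+|z-s|^3\big)$, $$(\boldsymbol S_\infty)_{jk}=\int_0^\infty \boldsymbol c_j\,g(\boldsymbol D_j^k;s)\,\boldsymbol c_k^\top\,\rho_\infty(s)\,ds,$$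 and $\boldsymbol S_\infty$ is the finite element stiffness matrix of the integral fractional Laplacian $(-\Delta)^{\alpha/2}$ on $\mathbb R$: $$(\boldsymbol S_\infty)_{jk}=\frac{C_\alpha}2\iint_{\mathbb R^2}\frac{(\tilde\phi_j(x)-\tilde\phi_j(y))(\tilde\phi_k(x)-\tilde\phi_k(y))}{|x-y|^{1+\alpha}}\,dx\,dy=\int_{\mathbb R}|\xi|^\alpha\,\mathscr F[\tilde\phi_j](\xi)\,\overline{\mathscr F[\tilde\phi_k](\xi)}\,d\xi,$$ where $\mathscr F[u](\xi)=(2\pi)^{-1/2}\int_{\mathbb R}e^{-\mathrm i x\xi}u(x)\,dx$. The integrals in the last two displays converge absolutely. -/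

import Mathlib

noncomputable section

namespace NonlocalFEM

/-- A partition `a = x_0 < x_1 < ⋯ < x_{N+1} = b` of the interval `(a, b)`. -/
structure Mesh (a b : ℝ) (N : ℕ) where
  /-- the nodes `x_0, …, x_{N+1}` -/
  x : Fin (N + 2) → ℝ
  strictMono : StrictMono x
  left : x 0 = a
  right : x (Fin.last (N + 1)) = b

namespace Mesh

variable {a b : ℝ} {N : ℕ}

/-- The three nodes `(x_{i-1}, x_i, x_{i+1})` around an interior node. The interior nodes are
numbered by `j : Fin N`, the index `j` standing for `i = j + 1`, `1 ≤ i ≤ N`. -/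
def nodes (M : Mesh a b N) (j : Fin N) : Fin 3 → ℝ :=
  ![M.x j.castSucc.castSucc, M.x j.castSucc.succ, M.x j.succ.succ]

/-- The length `h_i` of the mesh cell to the left of the interior node. -/
def hL (M : Mesh a b N) (j : Fin N) : ℝ := M.nodes j 1 - M.nodes j 0

/-- The length `h_{i+1}` of the mesh cell to the right of the interior node. -/
def hR (M : Mesh a b N) (j : Fin N) : ℝ := M.nodes j 2 - M.nodes j 1

/-- The piecewise linear nodal basis function, extended by zero to the whole line. -/
def hat (M : Mesh a b N) (j : Fin N) (t : ℝ) : ℝ :=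
  if M.nodes j 0 ≤ t ∧ t ≤ M.nodes j 1 then (t - M.nodes j 0) / M.hL j
  else if M.nodes j 1 < t ∧ t ≤ M.nodes j 2 then (M.nodes j 2 - t) / M.hR j
  else 0

/-- The row vector `c_i = (1/h_i, -1/h_i - 1/h_{i+1}, 1/h_{i+1})`. -/
def c (M : Mesh a b N) (j : Fin N) : Fin 3 → ℝ :=
  ![1 / M.hL j, -(1 / M.hL j) - 1 / M.hR j, 1 / M.hR j]

/-- The `3 × 3` matrix of the distances between the nodes around two interior nodes. -/
def D (M : Mesh a b N) (j k : Fin N) : Matrix (Fin 3) (Fin 3) ℝ :=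
  Matrix.of fun p q => |M.nodes j p - M.nodes k q|

/-- The number `c_j F(D_j^k) c_kᵀ`, where `F` acts on the matrix entry by entry. -/
def sandwich (M : Mesh a b N) (F : ℝ → ℝ) (j k : Fin N) : ℝ :=
  M.c j ⬝ᵥ (((M.D j k).map F).mulVec (M.c k))

end Mesh

/-- The constant `C_α` of the fractional kernel. -/
def Cconst (α : ℝ) : ℝ :=
  2 ^ (α - 1) * α * Real.Gamma ((1 + α) / 2) / (√Real.pi * Real.Gamma (1 - α / 2))

/-- The fractional kernel `ρ_∞(s) = C_α s^{-1-α}` (used for `s > 0` only). -/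
def rhoInf (α s : ℝ) : ℝ := Cconst α / s ^ (1 + α)

/-- The truncated fractional kernel `ρ_δ = ρ_∞ χ_(0,δ)`. -/
def rhoTrunc (α δ s : ℝ) : ℝ := (Set.Ioo 0 δ).indicator (rhoInf α) s

/-- `g(z; s) = -(|z+s|³ - 2|z|³ + |z-s|³) / 12`. -/
def g (s z : ℝ) : ℝ := -(1 / 12) * (|z + s| ^ 3 - 2 * |z| ^ 3 + |z - s| ^ 3)

variable {a b : ℝ} {N : ℕ}

/-- The entry `I_jk(s) = c_j g(D_j^k; s) c_kᵀ`. -/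
def Mesh.I (M : Mesh a b N) (s : ℝ) (j k : Fin N) : ℝ := M.sandwich (g s) j k

/-- The nonlocal finite element stiffness matrix with kernel `ρ` and horizon `δ`, that is
the bilinear form
`½ ∫ ∫_{-δ}^{δ} (u(t+s) - u(t)) (v(t+s) - v(t)) ρ(|s|) ds dt` evaluated at the
(zero extended) basis functions. -/
def Mesh.stiffness (M : Mesh a b N) (ρ : ℝ → ℝ) (δ : ℝ) : Matrix (Fin N) (Fin N) ℝ :=
  Matrix.of fun j k => 1 / 2 * ∫ t : ℝ, ∫ s in (-δ)..δ,
    (M.hat j (t + s) - M.hat j t) * (M.hat k (t + s) - M.hat k t) * ρ |s|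

/-- The integrand `(u(t) - u(y)) (v(t) - v(y)) C_α / |t - y|^{1+α}` of the energy form of the
integral fractional Laplacian `(-Δ)^{α/2}` at two basis functions. -/
def Mesh.energyDensity (M : Mesh a b N) (α : ℝ) (j k : Fin N) (p : ℝ × ℝ) : ℝ :=
  (M.hat j p.1 - M.hat j p.2) * (M.hat k p.1 - M.hat k p.2) *
    (Cconst α / |p.1 - p.2| ^ (1 + α))

/-- The finite element stiffness matrix of the integral fractional Laplacian `(-Δ)^{α/2}` on the
line, for basis functions vanishing outside `(a, b)`. -/
def Mesh.fracStiffness (M : Mesh a b N) (α : ℝ) : Matrix (Fin N) (Fin N) ℝ :=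
  Matrix.of fun j k => 1 / 2 * ∫ p : ℝ × ℝ, M.energyDensity α j k p

/-- The unitary Fourier transform `(2π)^{-1/2} ∫ e^{-i t ξ} u(t) dt`. -/
def fourierU (u : ℝ → ℝ) (ξ : ℝ) : ℂ :=
  ((1 / √(2 * Real.pi) : ℝ) : ℂ) *
    ∫ t : ℝ, Complex.exp (-Complex.I * (t : ℂ) * (ξ : ℂ)) * ((u t : ℝ) : ℂ)

/-- The integrand `|ξ|^α û(ξ) conj v̂(ξ)` of the energy form of `(-Δ)^{α/2}` on the Fourier side,
at two basis functions. -/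
def Mesh.symbolDensity (M : Mesh a b N) (α : ℝ) (j k : Fin N) (ξ : ℝ) : ℂ :=
  ((|ξ| ^ α : ℝ) : ℂ) * fourierU (M.hat j) ξ * star (fourierU (M.hat k) ξ)

/-- The claimed entries: `c_j (D_j^k)^{3-α} c_kᵀ / (2 Γ(4-α) cos(απ/2))` for `α ≠ 1`, and
`c_j ((D_j^k)² ln D_j^k) c_kᵀ / (2π)` for `α = 1` (with `0² ln 0 = 0`). -/
def Mesh.entry (M : Mesh a b N) (α : ℝ) (j k : Fin N) : ℝ :=
  if α = 1 then
    1 / (2 * Real.pi) * M.sandwich (fun d => d ^ 2 * Real.log d) j k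
  else
    1 / (2 * Real.Gamma (4 - α) * Real.cos (α * Real.pi / 2)) *
      M.sandwich (fun d => d ^ (3 - α)) j k

end NonlocalFEM

end

section

open MeasureTheory Set Filter Topology

namespace NonlocalFEM

/-! A hat function is the second difference, with weights `c`, of the fundamental solution `|x - t|
/ 2` of the second derivative. Integrating by parts twice, pairing a hat with `f''` gives the second
difference of `f`. Since `(|u|³ / 12)'' = |u| / 2`, the correlation of two hats at shift `s` is a
double second difference of `|·|³ / 12`. Expanding the product of two increments gives `∫ (Δ_s
φ_j)(Δ_s φ_k) = I_jk(s) = c_j g(D; s) c_kᵀ` (`integral_hatDiff_mul`).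

It remains to integrate `I_jk` against `ρ_∞`. For fixed `z` the function `g(z; s)` is polynomial in
`s` on each side of `s = z`, so the integral over `(0, T)` is elementary. The weights `c` annihilate
affine functions, so the sandwich kills constants and `d²`. This removes every term that grows with
`T`, as well as `d^(3-α)` itself when `α = 1`, leaving the logarithm. The remaining coefficient
becomes the stated one by the reflection and duplication formulas for Gamma (`Cconst_mul_cos`).

Fubini carries this value to the truncated matrices and, after the shear `(t, s) ↦ (t, t + s)`, to
the energy form. The diagonal density is nonnegative, so its integrability follows from that of
`I_jj ρ_∞`; the off-diagonal ones are dominated by diagonal ones.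

On the Fourier side, Plancherel gives `I_jk(s) = ∫ 2 (1 - cos sξ) φ̂_j conj φ̂_k dξ`. The constant
`C_α` is exactly the one for which `∫₀^∞ 2 (1 - cos sξ) ρ_∞(s) ds = |ξ|^α`, and one more use of
Fubini finishes the proof. -/

/-- The piecewise linear function with nodes `l < m < r` and value `1` at `m`. -/
noncomputable def tent (l m r t : ℝ) : ℝ :=
  if l ≤ t ∧ t ≤ m then (t - l) / (m - l)
  else if m < t ∧ t ≤ r then (r - t) / (r - m)
  else 0

/-- The second order difference functional at `l < m < r`, which is the second distributional
derivative of `tent l m r`. -/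
noncomputable def secondDiff {E : Type*} [AddCommGroup E] [Module ℝ E] (l m r : ℝ) (f : ℝ → E) :
    E :=
  (1 / (m - l)) • f l + (-(1 / (m - l)) - 1 / (r - m)) • f m + (1 / (r - m)) • f r

lemma hasDerivAt_secondDiff {E : Type*} [NormedAddCommGroup E] [NormedSpace ℝ E] {l m r t : ℝ}
    {F : ℝ → ℝ → E} {F' : ℝ → E} (h : ∀ x, HasDerivAt (F x) (F' x) t) :
    HasDerivAt (fun y => secondDiff l m r fun x => F x y) (secondDiff l m r F') t :=
  (((h l).const_smul (1 / (m - l))).add ((h m).const_smul (-(1 / (m - l)) - 1 / (r - m)))).add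
    ((h r).const_smul (1 / (r - m)))

/-! ### Hat functions as second differences of the absolute value. -/

section Tent

variable {l m r : ℝ}

/-- Outside `[l, r]` the three absolute values have one common sign, so the second difference sees
an affine function of the node and vanishes. -/
lemma tent_eq_secondDiff_abs (hlm : l < m) (hmr : m < r) (t : ℝ) :
    tent l m r t = secondDiff l m r fun x => |x - t| / 2 := by
  have h1 : m - l ≠ 0 := by linarith
  have h2 : r - m ≠ 0 := by linarith
  simp only [tent, secondDiff, smul_eq_mul]
  split_ifs with h h'
  · rw [abs_of_nonpos (by linarith : l - t ≤ 0), abs_of_nonneg (by linarith : 0 ≤ m - t),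
      abs_of_nonneg (by linarith : 0 ≤ r - t)]
    field_simp
    ring
  · rw [abs_of_nonpos (by linarith : l - t ≤ 0), abs_of_nonpos (by linarith : m - t ≤ 0),
      abs_of_nonneg (by linarith : 0 ≤ r - t)]
    field_simp
    ring
  · rcases lt_or_ge t l with h3 | h3
    · rw [abs_of_nonneg (by linarith : 0 ≤ l - t), abs_of_nonneg (by linarith : 0 ≤ m - t),
        abs_of_nonneg (by linarith : 0 ≤ r - t)]
      field_simp
      ring
    · have h4 : m < t := by
        by_contra h5
        exact h ⟨h3, not_lt.1 h5⟩
      have h6 : r < t := by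
        by_contra h5
        exact h' ⟨h4, not_lt.1 h5⟩
      rw [abs_of_nonpos (by linarith : l - t ≤ 0), abs_of_nonpos (by linarith : m - t ≤ 0),
        abs_of_nonpos (by linarith : r - t ≤ 0)]
      field_simp
      ring

lemma continuous_tent (hlm : l < m) (hmr : m < r) : Continuous (tent l m r) := by
  have : tent l m r = fun t => secondDiff l m r fun x => |x - t| / 2 :=
    funext (tent_eq_secondDiff_abs hlm hmr)
  rw [this]
  unfold secondDiff
  fun_prop

lemma support_tent_subset (hlm : l < m) (hmr : m < r) :
    Function.support (tent l m r) ⊆ Ioc l r := by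
  intro t ht
  by_contra h
  apply ht
  unfold tent
  split_ifs with h1 h2
  · rcases h1.1.eq_or_lt with h3 | h3
    · simp [h3]
    · exact absurd ⟨h3, by linarith⟩ h
  · exact absurd ⟨by linarith, h2.2⟩ h
  · rfl

lemma hasCompactSupport_tent (hlm : l < m) (hmr : m < r) : HasCompactSupport (tent l m r) :=
  HasCompactSupport.of_support_subset_isCompact (isCompact_Icc (a := l) (b := r))
    ((support_tent_subset hlm hmr).trans Ioc_subset_Icc_self)

/-- Integrating a hat function against a second derivative. -/
lemma integral_tent_smul_deriv2 {E : Type*} [NormedAddCommGroup E] [NormedSpace ℝ E]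
    [CompleteSpace E] (hlm : l < m) (hmr : m < r) {f f' f'' : ℝ → E}
    (hf : ∀ t, HasDerivAt f (f' t) t) (hf' : ∀ t, HasDerivAt f' (f'' t) t)
    (hc : Continuous f'') :
    ∫ t, tent l m r t • f'' t = secondDiff l m r f := by
  have h1 : m - l ≠ 0 := by linarith
  have h2 : r - m ≠ 0 := by linarith
  have hcont : Continuous fun t => tent l m r t • f'' t := (continuous_tent hlm hmr).smul hc
  have hs : Function.support (fun t => tent l m r t • f'' t) ⊆ Ioc l r :=
    fun t ht => support_tent_subset hlm hmr fun h => ht (by simp [h])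
  rw [← intervalIntegral.integral_eq_integral_of_support_subset hs,
    ← intervalIntegral.integral_add_adjacent_intervals
      (hcont.intervalIntegrable l m) (hcont.intervalIntegrable m r)]
  have e1 : ∫ t in l..m, tent l m r t • f'' t = ∫ t in l..m, ((t - l) / (m - l)) • f'' t := by
    refine intervalIntegral.integral_congr fun t ht => ?_
    rw [uIcc_of_le hlm.le] at ht
    simp only [tent, if_pos (show l ≤ t ∧ t ≤ m from ht)]
  have e2 : ∫ t in m..r, tent l m r t • f'' t = ∫ t in m..r, ((r - t) / (r - m)) • f'' t := by
    refine intervalIntegral.integral_congr fun t ht => ?_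
    rw [uIcc_of_le hmr.le] at ht
    simp only [tent]
    rcases ht.1.eq_or_lt with h3 | h3
    · subst h3
      rw [if_pos ⟨hlm.le, le_rfl⟩, div_self h1, div_self h2]
    · rw [if_neg (fun h => absurd h.2 (not_le.2 h3)), if_pos ⟨h3, ht.2⟩]
  -- On each half the antiderivative comes from one integration by parts. The terms in `f' m` from
  -- the two halves cancel, since the hat is continuous at `m`; the jumps of its slope produce the
  -- second difference.
  have d1 : ∀ t, HasDerivAt (fun t => ((t - l) / (m - l)) • f' t - (1 / (m - l)) • f t)
      (((t - l) / (m - l)) • f'' t) t := by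
    intro t
    convert! ((((hasDerivAt_id t).sub_const l).div_const (m - l)).smul (hf' t)).sub
      ((hf t).const_smul (1 / (m - l))) using 1
    simp
  have d2 : ∀ t, HasDerivAt (fun t => ((r - t) / (r - m)) • f' t + (1 / (r - m)) • f t)
      (((r - t) / (r - m)) • f'' t) t := by
    intro t
    convert! ((((hasDerivAt_id t).const_sub r).div_const (r - m)).smul (hf' t)).add
      ((hf t).const_smul (1 / (r - m))) using 1
    simp [neg_div]
  rw [e1, e2, intervalIntegral.integral_eq_sub_of_hasDerivAt (fun t _ => d1 t)
      (Continuous.intervalIntegrable (by fun_prop) _ _),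
    intervalIntegral.integral_eq_sub_of_hasDerivAt (fun t _ => d2 t)
      (Continuous.intervalIntegrable (by fun_prop) _ _)]
  simp only [secondDiff, sub_self, zero_div, zero_smul, div_self h1, div_self h2]
  module

end Tent

/-! ### Antiderivatives of the absolute value and correlations of hats. -/

lemma hasDerivAt_abs_mul_self (x : ℝ) : HasDerivAt (fun x : ℝ => |x| * x) (2 * |x|) x := by
  rcases lt_trichotomy x 0 with h | rfl | h
  · have : (fun x : ℝ => |x| * x) =ᶠ[𝓝 x] fun x => -(x ^ 2) := by
      filter_upwards [gt_mem_nhds h] with y hy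
      rw [abs_of_neg hy]; ring
    refine HasDerivAt.congr_of_eventuallyEq ?_ this
    convert! (hasDerivAt_pow 2 x).neg using 1
    rw [abs_of_neg h]; simp
  · rw [hasDerivAt_iff_tendsto_slope_zero]
    simp only [zero_add, abs_zero, mul_zero, sub_zero, smul_eq_mul]
    have : Tendsto (fun t : ℝ => |t|) (𝓝[≠] 0) (𝓝 0) := by
      simpa using (continuous_abs.tendsto (0 : ℝ)).mono_left nhdsWithin_le_nhds
    refine this.congr' ?_
    filter_upwards [self_mem_nhdsWithin] with t ht
    field_simp [show t ≠ 0 from ht]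
  · have : (fun x : ℝ => |x| * x) =ᶠ[𝓝 x] fun x => x ^ 2 := by
      filter_upwards [lt_mem_nhds h] with y hy
      rw [abs_of_pos hy]; ring
    refine HasDerivAt.congr_of_eventuallyEq ?_ this
    convert! hasDerivAt_pow 2 x using 1
    rw [abs_of_pos h]; simp

lemma hasDerivAt_abs_pow_three (x : ℝ) :
    HasDerivAt (fun x : ℝ => |x| ^ 3) (3 * (|x| * x)) x := by
  have : (fun x : ℝ => |x| ^ 3) = fun x => (|x| * x) * x := by
    ext y
    rw [pow_succ, sq_abs]; ring
  rw [this]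
  convert! (hasDerivAt_abs_mul_self x).mul (hasDerivAt_id x) using 1
  simp; ring

/-- The correlation of two hat functions. -/
lemma integral_tent_mul_tent_add {l m r l' m' r' : ℝ} (hlm : l < m) (hmr : m < r)
    (hlm' : l' < m') (hmr' : m' < r') (s : ℝ) :
    ∫ t, tent l' m' r' t * tent l m r (t + s) =
      secondDiff l' m' r' fun y => secondDiff l m r fun x => |x - s - y| ^ 3 / 12 := by
  have h1 : ∀ x t : ℝ, HasDerivAt (fun t => |x - s - t| ^ 3 / 12)
      (-(|x - s - t| * (x - s - t)) / 4) t := by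
    intro x t
    convert! ((hasDerivAt_abs_pow_three (x - s - t)).comp t
      ((hasDerivAt_id t).const_sub (x - s))).div_const 12 using 1
    ring
  have h2 : ∀ x t : ℝ, HasDerivAt (fun t => -(|x - s - t| * (x - s - t)) / 4)
      (|x - s - t| / 2) t := by
    intro x t
    convert! ((hasDerivAt_abs_mul_self (x - s - t)).comp t
      ((hasDerivAt_id t).const_sub (x - s))).neg.div_const 4 using 1
    ring
  -- As a function of `y`, this `f''` is the shifted hat `tent l m r (y + s)`, and `f` is its second
  -- antiderivative.
  have key := integral_tent_smul_deriv2 hlm' hmr'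
    (f := fun y => secondDiff l m r fun x => |x - s - y| ^ 3 / 12)
    (f' := fun y => secondDiff l m r fun x => -(|x - s - y| * (x - s - y)) / 4)
    (f'' := fun y => secondDiff l m r fun x => |x - s - y| / 2)
    (fun t => hasDerivAt_secondDiff (F := fun x y => |x - s - y| ^ 3 / 12) fun x => h1 x t)
    (fun t => hasDerivAt_secondDiff (F := fun x y => -(|x - s - y| * (x - s - y)) / 4)
      fun x => h2 x t)
    (by unfold secondDiff; fun_prop)
  rw [← key]
  congr 1
  ext t
  rw [tent_eq_secondDiff_abs hlm hmr, smul_eq_mul]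
  simp only [sub_sub, add_comm]

/-! ### Algebra of the weights `c` and of the sandwich. -/

namespace Mesh

variable {a b : ℝ} {N : ℕ} (M : Mesh a b N) (j k : Fin N)

lemma nodes_zero_lt_one : M.nodes j 0 < M.nodes j 1 :=
  M.strictMono (Fin.castSucc_lt_succ (i := j.castSucc))

lemma nodes_one_lt_two : M.nodes j 1 < M.nodes j 2 :=
  M.strictMono (by simp [Fin.lt_def])

lemma hat_eq_tent : M.hat j = tent (M.nodes j 0) (M.nodes j 1) (M.nodes j 2) := rfl

lemma sum_c_smul {E : Type*} [AddCommGroup E] [Module ℝ E] (f : ℝ → E) :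
    ∑ p, M.c j p • f (M.nodes j p) =
      secondDiff (M.nodes j 0) (M.nodes j 1) (M.nodes j 2) f := by
  simp [Fin.sum_univ_three, c, secondDiff, hL, hR]

lemma sandwich_eq_sum (F : ℝ → ℝ) :
    M.sandwich F j k = ∑ p, ∑ q, M.c j p * M.c k q * F |M.nodes j p - M.nodes k q| := by
  simp only [sandwich, dotProduct, Matrix.mulVec, D, Matrix.map_apply, Matrix.of_apply,
    Finset.mul_sum]
  exact Finset.sum_congr rfl fun p _ => Finset.sum_congr rfl fun q _ => by ring

lemma sum_c : ∑ p, M.c j p = 0 := by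
  simp only [Fin.sum_univ_three, c, Matrix.cons_val]
  ring

lemma sum_c_mul_nodes : ∑ p, M.c j p * M.nodes j p = 0 := by
  have h1 : M.nodes j 1 - M.nodes j 0 ≠ 0 := by linarith [M.nodes_zero_lt_one j]
  have h2 : M.nodes j 2 - M.nodes j 1 ≠ 0 := by linarith [M.nodes_one_lt_two j]
  simp only [Fin.sum_univ_three, c, hL, hR, Matrix.cons_val]
  field_simp
  ring

lemma sandwich_const (r : ℝ) : M.sandwich (fun _ => r) j k = 0 := by
  rw [sandwich_eq_sum]
  simp_rw [← Finset.sum_mul, ← Finset.mul_sum, sum_c]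
  simp

/-- Each term of `(x - y)² = x² - 2xy + y²` has degree at most one in one of the variables, and the
weights in that variable annihilate it. -/
lemma sandwich_sq : M.sandwich (fun d => d ^ 2) j k = 0 := by
  rw [sandwich_eq_sum]
  have h : ∀ p, ∑ q, M.c j p * M.c k q * |M.nodes j p - M.nodes k q| ^ 2 =
      M.c j p * ∑ q, M.c k q * M.nodes k q ^ 2 := by
    intro p
    have : ∀ q, M.c j p * M.c k q * |M.nodes j p - M.nodes k q| ^ 2 =
        M.c j p * M.nodes j p ^ 2 * M.c k q - 2 * M.c j p * M.nodes j p *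
          (M.c k q * M.nodes k q) + M.c j p * (M.c k q * M.nodes k q ^ 2) := by
      intro q
      rw [sq_abs]; ring
    simp_rw [this, Finset.sum_add_distrib, Finset.sum_sub_distrib, ← Finset.mul_sum, sum_c,
      sum_c_mul_nodes]
    simp
  simp_rw [h, ← Finset.sum_mul, sum_c]
  simp

lemma sandwich_add (F G : ℝ → ℝ) :
    M.sandwich (fun d => F d + G d) j k = M.sandwich F j k + M.sandwich G j k := by
  simp only [sandwich_eq_sum, mul_add, Finset.sum_add_distrib]

lemma sandwich_const_mul (r : ℝ) (F : ℝ → ℝ) :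
    M.sandwich (fun d => r * F d) j k = r * M.sandwich F j k := by
  simp only [sandwich_eq_sum, Finset.mul_sum]
  exact Finset.sum_congr rfl fun p _ => Finset.sum_congr rfl fun q _ => by ring

lemma sandwich_congr {F G : ℝ → ℝ} (h : ∀ p q, F (M.D j k p q) = G (M.D j k p q)) :
    M.sandwich F j k = M.sandwich G j k := by
  simp only [sandwich_eq_sum]
  exact Finset.sum_congr rfl fun p _ => Finset.sum_congr rfl fun q _ => by
    rw [show F |M.nodes j p - M.nodes k q| = G |M.nodes j p - M.nodes k q| from h p q]

lemma D_nonneg (p q : Fin 3) : 0 ≤ M.D j k p q := abs_nonneg _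

lemma exists_D_lt : ∃ Z : ℝ, 0 < Z ∧ ∀ p q, M.D j k p q < Z := by
  obtain ⟨Z, hZ⟩ := (Set.finite_range fun x : Fin 3 × Fin 3 => M.D j k x.1 x.2).bddAbove
  refine ⟨|Z| + 1, by positivity, fun p q => ?_⟩
  have := hZ ⟨(p, q), rfl⟩
  have h2 := le_abs_self Z
  simp only at this
  linarith

lemma continuous_hat : Continuous (M.hat j) :=
  continuous_tent (M.nodes_zero_lt_one j) (M.nodes_one_lt_two j)

lemma hasCompactSupport_hat : HasCompactSupport (M.hat j) :=
  hasCompactSupport_tent (M.nodes_zero_lt_one j) (M.nodes_one_lt_two j)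

lemma integrable_hat : Integrable (M.hat j) :=
  (M.continuous_hat j).integrable_of_hasCompactSupport (M.hasCompactSupport_hat j)

lemma integral_hat_mul_hat_add (s : ℝ) :
    ∫ t, M.hat k t * M.hat j (t + s) =
      ∑ p, ∑ q, M.c j p * M.c k q * (|M.nodes j p - M.nodes k q - s| ^ 3 / 12) := by
  simp only [hat_eq_tent]
  rw [integral_tent_mul_tent_add (M.nodes_zero_lt_one j) (M.nodes_one_lt_two j)
    (M.nodes_zero_lt_one k) (M.nodes_one_lt_two k)]
  simp only [← sum_c_smul, smul_eq_mul, Finset.mul_sum]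
  rw [Finset.sum_comm]
  refine Finset.sum_congr rfl fun p _ => Finset.sum_congr rfl fun q _ => ?_
  rw [sub_right_comm]
  ring

end Mesh

/-! ### The function `g` and the correlation of increments. -/

/-- Evenness in `z` lets signed node differences replace the distances in `D`. -/
lemma g_abs (s z : ℝ) : g s |z| = g s z := by
  rcases abs_choice z with h | h
  · rw [h]
  · rw [h]
    unfold g
    rw [abs_neg, show -z + s = -(z - s) by ring, show -z - s = -(z + s) by ring, abs_neg, abs_neg]
    ring

lemma g_neg (s z : ℝ) : g (-s) z = g s z := by
  unfold g
  rw [sub_neg_eq_add, ← sub_eq_add_neg]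
  ring

lemma g_of_le {s z : ℝ} (hs : 0 ≤ s) (h : s ≤ z) : g s z = -(z * s ^ 2 / 2) := by
  unfold g
  rw [abs_of_nonneg (by linarith : 0 ≤ z + s), abs_of_nonneg (by linarith : 0 ≤ z),
    abs_of_nonneg (by linarith : 0 ≤ z - s)]
  ring

lemma g_of_ge {s z : ℝ} (hz : 0 ≤ z) (h : z ≤ s) :
    g s z = -((s ^ 3 + 3 * s * z ^ 2 - z ^ 3) / 6) := by
  unfold g
  rw [abs_of_nonneg (by linarith : 0 ≤ z + s), abs_of_nonneg (by linarith : 0 ≤ z),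
    abs_of_nonpos (by linarith : z - s ≤ 0)]
  ring

lemma continuous_g (z : ℝ) : Continuous fun s => g s z := by
  unfold g
  fun_prop

namespace Mesh

variable {a b : ℝ} {N : ℕ} (M : Mesh a b N) (j k : Fin N)

lemma I_eq_sum (s : ℝ) :
    M.I s j k = ∑ p, ∑ q, M.c j p * M.c k q * g s (M.D j k p q) :=
  sandwich_eq_sum ..

lemma I_neg (s : ℝ) : M.I (-s) j k = M.I s j k := by
  simp only [I_eq_sum, g_neg]

lemma I_abs (s : ℝ) : M.I |s| j k = M.I s j k := by
  rcases abs_choice s with h | h <;> rw [h]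
  exact M.I_neg j k s

/-- The difference of `M.hat j` over the step `s`. -/
noncomputable def hatDiff (s t : ℝ) : ℝ := M.hat j (t + s) - M.hat j t

lemma continuous_hatDiff (s : ℝ) : Continuous (M.hatDiff j s) :=
  ((M.continuous_hat j).comp (continuous_add_const s)).sub (M.continuous_hat j)

lemma hasCompactSupport_hatDiff (s : ℝ) : HasCompactSupport (M.hatDiff j s) :=
  ((M.hasCompactSupport_hat j).comp_homeomorph (Homeomorph.addRight s)).sub
    (M.hasCompactSupport_hat j)

lemma integrable_hatDiff (s : ℝ) : Integrable (M.hatDiff j s) :=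
  (M.continuous_hatDiff j s).integrable_of_hasCompactSupport (M.hasCompactSupport_hatDiff j s)

lemma integrable_hatDiff_mul (s : ℝ) :
    Integrable fun t => M.hatDiff j s t * M.hatDiff k s t :=
  ((M.continuous_hatDiff j s).mul
    (M.continuous_hatDiff k s)).integrable_of_hasCompactSupport
      ((M.hasCompactSupport_hatDiff j s).mul_right)

/-- Of the four products, the two with equal shifts each contribute the correlation at shift `0`;
the mixed ones contribute correlations at `s` and `-s`. The combination is the second difference in
`s` defining `g`. -/
lemma integral_hatDiff_mul (s : ℝ) :
    ∫ t, M.hatDiff j s t * M.hatDiff k s t = M.I s j k := by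
  have hcc : ∀ (i i' : Fin N) (r r' : ℝ),
      Integrable fun t => M.hat i (t + r) * M.hat i' (t + r') := fun i i' r r' =>
    (((M.continuous_hat i).comp (continuous_add_const r)).mul
      ((M.continuous_hat i').comp (continuous_add_const r'))).integrable_of_hasCompactSupport
        (((M.hasCompactSupport_hat i).comp_homeomorph (Homeomorph.addRight r)).mul_right)
  have i1 := hcc k j s s
  have i2 := hcc k j 0 s
  have i3 := hcc k j s 0
  have i4 := hcc k j 0 0
  simp only [add_zero] at i2 i3 i4
  have e : ∀ t, M.hatDiff j s t * M.hatDiff k s t =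
      M.hat k (t + s) * M.hat j (t + s) - M.hat k t * M.hat j (t + s)
        - M.hat k (t + s) * M.hat j t + M.hat k t * M.hat j t := by
    intro t
    unfold hatDiff
    ring
  simp_rw [e]
  have i12 : Integrable fun t => M.hat k (t + s) * M.hat j (t + s) - M.hat k t * M.hat j (t + s) :=
    i1.sub i2
  have i123 : Integrable fun t => M.hat k (t + s) * M.hat j (t + s) - M.hat k t * M.hat j (t + s)
      - M.hat k (t + s) * M.hat j t := i12.sub i3
  rw [integral_add i123 i4, integral_sub i12 i3, integral_sub i1 i2,
    integral_add_right_eq_self (fun t => M.hat k t * M.hat j t) s,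
    ← integral_add_right_eq_self (fun t => M.hat k (t + s) * M.hat j t) (-s)]
  have h0 := M.integral_hat_mul_hat_add j k 0
  simp only [add_zero, sub_zero] at h0
  simp only [neg_add_cancel_right]
  rw [h0, M.integral_hat_mul_hat_add j k s, M.integral_hat_mul_hat_add j k (-s), I_eq_sum]
  simp only [← Finset.sum_sub_distrib, ← Finset.sum_add_distrib]
  refine Finset.sum_congr rfl fun p _ => Finset.sum_congr rfl fun q _ => ?_
  rw [D, Matrix.of_apply, g_abs]
  unfold g
  rw [sub_neg_eq_add]
  ring

/-- Beyond all distances `g` is a cubic in `d` whose only `s`-dependent coefficients belong to `1`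
and `d²`, both annihilated. Being constant here, `I` is integrable against `ρ_∞` at infinity. -/
lemma I_of_large {s : ℝ} (hs : ∀ p q, M.D j k p q ≤ s) :
    M.I s j k = M.sandwich (fun d => d ^ 3) j k / 6 := by
  have : M.I s j k = M.sandwich (fun d => -(s ^ 3 / 6) + ((-(s / 2)) * d ^ 2 + 1 / 6 * d ^ 3)) j k :=
    M.sandwich_congr j k fun p q => by
      rw [g_of_ge (M.D_nonneg j k p q) (hs p q)]
      ring
  rw [this, sandwich_add, sandwich_add, sandwich_const_mul, sandwich_const_mul, sandwich_sq,
    sandwich_const]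
  ring

end Mesh

/-! ### Integrals of `g(z; s) s^(-1-α)` in `s`. -/

section Radial

variable {α : ℝ}

lemma intervalIntegrable_g_div_inner (hα : α ∈ Ioo (0 : ℝ) 2) {z : ℝ} (hz : 0 ≤ z) :
    IntervalIntegrable (fun s => g s z / s ^ (1 + α)) volume 0 z ∧
      ∫ s in (0 : ℝ)..z, g s z / s ^ (1 + α) = -(z ^ (3 - α) / (2 * (2 - α))) := by
  have hr : -1 < 1 - α := by linarith [hα.2]
  have he : ∀ s ∈ uIoc 0 z, -(z / 2) * s ^ (1 - α) = g s z / s ^ (1 + α) := by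
    intro s hs
    rw [uIoc_of_le hz] at hs
    have hp := Real.rpow_pos_of_pos hs.1 (1 + α)
    rw [g_of_le hs.1.le hs.2, eq_div_iff hp.ne', mul_assoc, ← Real.rpow_add hs.1,
      show 1 - α + (1 + α) = (2 : ℕ) by push_cast; ring, Real.rpow_natCast]
    ring
  refine ⟨((intervalIntegral.intervalIntegrable_rpow' hr).const_mul (-(z / 2))).congr he, ?_⟩
  rw [← intervalIntegral.integral_congr_ae (Eventually.of_forall he),
    intervalIntegral.integral_const_mul, integral_rpow (Or.inl hr),
    Real.zero_rpow (by linarith [hα.2])]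
  have h2 : 2 - α ≠ 0 := by linarith [hα.2]
  have h3 : 1 - α + 1 ≠ 0 := by linarith [hα.2]
  rcases hz.eq_or_lt with rfl | hz
  · rw [Real.zero_rpow (show 3 - α ≠ 0 by linarith [hα.2])]; simp
  · have : z ^ (3 - α) = z * z ^ (2 - α) := by
      rw [← Real.rpow_one_add' hz.le (by linarith [hα.2])]
      ring_nf
    rw [this, show 1 - α + 1 = 2 - α by ring]
    field_simp
    ring

/-- Keeping the antiderivative `L` of `s^(-α)` abstract treats the power and the logarithm at once.
-/
lemma intervalIntegrable_g_div_outer (hα : α ∈ Ioo (0 : ℝ) 2) {z T : ℝ} (hz : 0 < z) (hT : z ≤ T)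
    {L : ℝ → ℝ} (hL : ∀ x, 0 < x → HasDerivAt L (x ^ (-α)) x) :
    IntervalIntegrable (fun s => g s z / s ^ (1 + α)) volume z T ∧
      ∫ s in z..T, g s z / s ^ (1 + α) =
        -((T ^ (3 - α) - z ^ (3 - α)) / (3 - α) + 3 * z ^ 2 * (L T - L z)
          + (z ^ 3 * T ^ (-α) - z ^ (3 - α)) / α) / 6 := by
  have hα0 := hα.1.ne'
  have h3 : 3 - α ≠ 0 := by linarith [hα.2]
  have hii : IntervalIntegrable (fun s => g s z / s ^ (1 + α)) volume z T := by
    refine ContinuousOn.intervalIntegrable fun s hs => ContinuousAt.continuousWithinAt ?_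
    rw [uIcc_of_le hT] at hs
    have : 0 < s := hz.trans_le hs.1
    exact (continuous_g z).continuousAt.div
      (Real.continuousAt_rpow_const _ _ (Or.inl this.ne')) (Real.rpow_pos_of_pos this _).ne'
  refine ⟨hii, ?_⟩
  have hd : ∀ s ∈ uIcc z T, HasDerivAt (fun s => -(s ^ (3 - α) / (3 - α) + 3 * z ^ 2 * L s
      + z ^ 3 * s ^ (-α) / α) / 6) (g s z / s ^ (1 + α)) s := by
    intro s hs
    rw [uIcc_of_le hT] at hs
    have h0 : 0 < s := hz.trans_le hs.1
    convert! ((((Real.hasDerivAt_rpow_const (p := 3 - α) (Or.inl h0.ne')).div_const (3 - α)).add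
      ((hL s h0).const_mul (3 * z ^ 2))).add
      (((Real.hasDerivAt_rpow_const (p := -α) (Or.inl h0.ne')).const_mul
        (z ^ 3)).div_const α)).neg.div_const 6 using 1
    have hp := Real.rpow_pos_of_pos h0 (1 + α)
    have e1 : s ^ (3 - α - 1) * s ^ (1 + α) = s ^ 3 := by
      rw [← Real.rpow_add h0, show 3 - α - 1 + (1 + α) = (3 : ℕ) by push_cast; ring,
        Real.rpow_natCast]
    have e2 : s ^ (-α) * s ^ (1 + α) = s := by
      rw [← Real.rpow_add h0, show -α + (1 + α) = 1 by ring, Real.rpow_one]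
    have e3 : s ^ (-α - 1) * s ^ (1 + α) = 1 := by
      rw [← Real.rpow_add h0, show -α - 1 + (1 + α) = 0 by ring, Real.rpow_zero]
    rw [g_of_ge hz.le hs.1, div_eq_iff hp.ne']
    field_simp
    linear_combination e1 + 3 * z ^ 2 * e2 - z ^ 3 * e3
  rw [intervalIntegral.integral_eq_sub_of_hasDerivAt hd hii]
  have e4 : z ^ 3 * z ^ (-α) = z ^ (3 - α) := by
    rw [sub_eq_add_neg, Real.rpow_add hz]
    norm_cast
  rw [e4]
  ring

lemma intervalIntegrable_g_div (hα : α ∈ Ioo (0 : ℝ) 2) {z T : ℝ} (hz : 0 ≤ z) (hT : z < T)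
    {L : ℝ → ℝ} (hL : ∀ x, 0 < x → HasDerivAt L (x ^ (-α)) x) :
    IntervalIntegrable (fun s => g s z / s ^ (1 + α)) volume 0 T ∧
      ∫ s in (0 : ℝ)..T, g s z / s ^ (1 + α) =
        -(z ^ (3 - α) / (2 * (2 - α))) -
        ((T ^ (3 - α) - z ^ (3 - α)) / (3 - α) + 3 * z ^ 2 * (L T - L z)
          + (z ^ 3 * T ^ (-α) - z ^ (3 - α)) / α) / 6 := by
  -- At `z = 0` the formula stays valid whatever `L 0` is, since `L` carries the factor `z²`.
  rcases hz.eq_or_lt with rfl | hz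
  · have hr : -1 < 2 - α := by linarith [hα.2]
    have he : ∀ s ∈ uIoc 0 T, -(1 / 6) * s ^ (2 - α) = g s 0 / s ^ (1 + α) := by
      intro s hs
      rw [uIoc_of_le hT.le] at hs
      have hp := Real.rpow_pos_of_pos hs.1 (1 + α)
      rw [g_of_ge le_rfl hs.1.le, eq_div_iff hp.ne', mul_assoc, ← Real.rpow_add hs.1,
        show 2 - α + (1 + α) = (3 : ℕ) by push_cast; ring, Real.rpow_natCast]
      ring
    refine ⟨((intervalIntegral.intervalIntegrable_rpow' hr).const_mul (-(1 / 6))).congr he, ?_⟩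
    rw [← intervalIntegral.integral_congr_ae (Eventually.of_forall he),
      intervalIntegral.integral_const_mul, integral_rpow (Or.inl hr),
      Real.zero_rpow (by linarith [hα.2]), Real.zero_rpow (by linarith [hα.2]),
      show 2 - α + 1 = 3 - α by ring]
    ring
  · obtain ⟨i1, e1⟩ := intervalIntegrable_g_div_inner hα hz.le
    obtain ⟨i2, e2⟩ := intervalIntegrable_g_div_outer hα hz hT.le hL
    refine ⟨i1.trans i2, ?_⟩
    rw [← intervalIntegral.integral_add_adjacent_intervals i1 i2, e1, e2]
    ring

lemma exists_rpow_primitive (α : ℝ) : ∃ L : ℝ → ℝ, ∀ x, 0 < x → HasDerivAt L (x ^ (-α)) x := by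
  by_cases h : α = 1
  · refine ⟨Real.log, fun x hx => ?_⟩
    rw [h, Real.rpow_neg_one]
    exact Real.hasDerivAt_log hx.ne'
  · have h1 : 1 - α ≠ 0 := fun h' => h (by linarith)
    refine ⟨fun x => x ^ (1 - α) / (1 - α), fun x hx => ?_⟩
    convert! (Real.hasDerivAt_rpow_const (p := 1 - α) (Or.inl hx.ne')).div_const (1 - α) using 1
    rw [show 1 - α - 1 = -α by ring]
    field_simp

end Radial

/-! ### The constant `C_α`. -/

lemma Cconst_pos {α : ℝ} (hα : α ∈ Ioo (0 : ℝ) 2) : 0 < Cconst α := by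
  have h1 := Real.Gamma_pos_of_pos (show 0 < (1 + α) / 2 by linarith [hα.1])
  have h2 := Real.Gamma_pos_of_pos (show 0 < 1 - α / 2 by linarith [hα.2])
  have h3 := hα.1
  unfold Cconst
  positivity

lemma Cconst_one : Cconst 1 = 1 / Real.pi := by
  unfold Cconst
  norm_num [Real.Gamma_one_half_eq]
  rw [← mul_inv, Real.mul_self_sqrt Real.pi_pos.le]

/-- Three steps of the functional equation reduce `Γ(4-α)` to `Γ(1-α)`; reflection at `(1+α)/2`
brings in the cosine and duplication at `(1-α)/2` eliminates the auxiliary factor `Γ((1-α)/2)`. -/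
lemma Cconst_mul_cos {α : ℝ} (hα : α ∈ Ioo (0 : ℝ) 2) (h1 : α ≠ 1) :
    Cconst α / (α * (1 - α) * (2 - α) * (3 - α)) =
      1 / (2 * Real.Gamma (4 - α) * Real.cos (α * Real.pi / 2)) := by
  have h1' : 1 - α ≠ 0 := fun h => h1 (by linarith)
  have h2 : 2 - α ≠ 0 := by linarith [hα.2]
  have h3 : 3 - α ≠ 0 := by linarith [hα.2]
  have hα0 := hα.1.ne'
  have hcos : Real.cos (α * Real.pi / 2) ≠ 0 := by
    intro h
    rw [Real.cos_eq_zero_iff] at h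
    obtain ⟨n, hn⟩ := h
    have hn' : α = 2 * n + 1 := by
      have := Real.pi_pos.ne'
      field_simp at hn
      linarith
    have l1 : (-1 : ℝ) < n := by linarith [hα.1]
    have l2 : (n : ℝ) < 1 := by linarith [hα.2]
    norm_cast at l1 l2
    have : n = 0 := by omega
    subst this
    exact h1 (by simpa using hn')
  have hG : Real.Gamma (4 - α) = (3 - α) * ((2 - α) * ((1 - α) * Real.Gamma (1 - α))) := by
    rw [← Real.Gamma_add_one h1', show 1 - α + 1 = 2 - α by ring, ← Real.Gamma_add_one h2,
      show 2 - α + 1 = 3 - α by ring, ← Real.Gamma_add_one h3, show 3 - α + 1 = 4 - α by ring]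
  have hG4 : Real.Gamma (4 - α) ≠ 0 := (Real.Gamma_pos_of_pos (by linarith [hα.2])).ne'
  have hG1 : Real.Gamma (1 - α) ≠ 0 := fun h => hG4 (by rw [hG, h]; simp)
  have hrefl := Real.Gamma_mul_Gamma_one_sub ((1 + α) / 2)
  rw [show Real.pi * ((1 + α) / 2) = α * Real.pi / 2 + Real.pi / 2 by ring,
    Real.sin_add_pi_div_two, show 1 - (1 + α) / 2 = (1 - α) / 2 by ring] at hrefl
  have hdup := Real.Gamma_mul_Gamma_add_half ((1 - α) / 2)
  rw [show (1 - α) / 2 + 1 / 2 = 1 - α / 2 by ring, show 2 * ((1 - α) / 2) = 1 - α by ring,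
    show 1 - (1 - α) = α by ring] at hdup
  have hA : Real.Gamma (1 - α / 2) ≠ 0 := (Real.Gamma_pos_of_pos (by linarith [hα.2])).ne'
  have hpow : (2 : ℝ) ^ α = 2 ^ (α - 1) * 2 := by
    rw [← Real.rpow_add_one two_ne_zero]; ring_nf
  have hpi : √Real.pi ≠ 0 := by positivity
  have hsq : √Real.pi * √Real.pi = Real.pi := Real.mul_self_sqrt Real.pi_pos.le
  rw [eq_div_iff hcos] at hrefl
  rw [hpow] at hdup
  -- The argument is negative for `α > 1`, so positivity is unavailable; reflection excludes zero
  -- because its right side is `π`.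
  have hB : Real.Gamma ((1 - α) / 2) ≠ 0 := by
    intro h
    rw [h] at hrefl
    simp only [mul_zero, zero_mul] at hrefl
    exact Real.pi_ne_zero hrefl.symm
  have main : 2 ^ (α - 1) * Real.Gamma ((1 + α) / 2) *
      (2 * Real.Gamma (1 - α) * Real.cos (α * Real.pi / 2)) =
        √Real.pi * Real.Gamma (1 - α / 2) := by
    apply mul_right_cancel₀ hB
    apply mul_right_cancel₀ hpi
    linear_combination 2 * 2 ^ (α - 1) * Real.Gamma (1 - α) * √Real.pi * hrefl
      - Real.pi * hdup - Real.Gamma (1 - α / 2) * Real.Gamma ((1 - α) / 2) * hsq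
  unfold Cconst
  rw [hG]
  generalize Real.Gamma (1 - α / 2) = A at *
  generalize Real.Gamma ((1 + α) / 2) = B at *
  field_simp
  linear_combination main

/-! ### The kernel integral of `I` and its closed form. -/

lemma intervalIntegrable_sum {ι : Type*} (S : Finset ι) {F : ι → ℝ → ℝ} {x y : ℝ}
    (h : ∀ i ∈ S, IntervalIntegrable (F i) volume x y) :
    IntervalIntegrable (fun s => ∑ i ∈ S, F i s) volume x y := by
  convert! IntervalIntegrable.sum S h using 1
  ext s
  rw [Finset.sum_apply]

namespace Mesh

variable {a b : ℝ} {N : ℕ} (M : Mesh a b N) (j k : Fin N) {α : ℝ}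

lemma I_mul_rhoInf_eq_sum (s : ℝ) :
    M.I s j k * rhoInf α s =
      ∑ p, ∑ q, Cconst α * (M.c j p * M.c k q) * (g s (M.D j k p q) / s ^ (1 + α)) := by
  simp only [I_eq_sum, rhoInf, Finset.sum_mul]
  exact Finset.sum_congr rfl fun p _ => Finset.sum_congr rfl fun q _ => by ring

lemma intervalIntegrable_I_mul_rhoInf (hα : α ∈ Ioo (0 : ℝ) 2) {T : ℝ}
    (hT : ∀ p q, M.D j k p q < T) :
    IntervalIntegrable (fun s => M.I s j k * rhoInf α s) volume 0 T := by
  obtain ⟨L, hL⟩ := exists_rpow_primitive α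
  simp only [I_mul_rhoInf_eq_sum]
  exact intervalIntegrable_sum _ fun p _ => intervalIntegrable_sum _ fun q _ =>
    ((intervalIntegrable_g_div hα (M.D_nonneg j k p q) (hT p q) hL).1).const_mul _

lemma intervalIntegral_I_mul_rhoInf (hα : α ∈ Ioo (0 : ℝ) 2) {T : ℝ}
    (hT : ∀ p q, M.D j k p q < T) {L : ℝ → ℝ} (hL : ∀ x, 0 < x → HasDerivAt L (x ^ (-α)) x) :
    ∫ s in (0 : ℝ)..T, M.I s j k * rhoInf α s =
      Cconst α * M.sandwich (fun d => (-(1 / (2 * (2 - α))) + 1 / (6 * (3 - α)) + 1 / (6 * α)) *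
        d ^ (3 - α) + 1 / 2 * (d ^ 2 * L d)) j k
        - Cconst α * M.sandwich (fun d => d ^ 3) j k / (6 * α) * T ^ (-α) := by
  have hg := fun p q => intervalIntegrable_g_div hα (M.D_nonneg j k p q) (hT p q) hL
  simp only [I_mul_rhoInf_eq_sum]
  rw [intervalIntegral.integral_finsetSum fun p _ => intervalIntegrable_sum _ fun q _ =>
    ((hg p q).1).const_mul _]
  simp_rw [intervalIntegral.integral_finsetSum fun q _ => ((hg _ q).1).const_mul _,
    intervalIntegral.integral_const_mul]
  have h1 : ∀ (F : ℝ → ℝ), ∑ p, ∑ q, Cconst α * (M.c j p * M.c k q) * F (M.D j k p q) =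
      Cconst α * M.sandwich F j k := by
    intro F
    simp only [sandwich_eq_sum, Finset.mul_sum]
    exact Finset.sum_congr rfl fun p _ => Finset.sum_congr rfl fun q _ => mul_assoc ..
  simp_rw [(hg _ _).2]
  rw [h1 fun d => -(d ^ (3 - α) / (2 * (2 - α))) - ((T ^ (3 - α) - d ^ (3 - α)) / (3 - α) +
    3 * d ^ 2 * (L T - L d) + (d ^ 3 * T ^ (-α) - d ^ (3 - α)) / α) / 6]
  -- Sorted by powers of `d`: `T^(3-α)` multiplies `1` and `L T` multiplies `d²`, so both drop out,
  -- and only the decaying `T^(-α)` keeps a dependence on `T`.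
  have h2 : (fun d : ℝ => -(d ^ (3 - α) / (2 * (2 - α))) - ((T ^ (3 - α) - d ^ (3 - α)) / (3 - α) +
      3 * d ^ 2 * (L T - L d) + (d ^ 3 * T ^ (-α) - d ^ (3 - α)) / α) / 6) =
      fun d => (((-(1 / (2 * (2 - α))) + 1 / (6 * (3 - α)) + 1 / (6 * α)) *
        d ^ (3 - α) + 1 / 2 * (d ^ 2 * L d)) + (-(T ^ (3 - α) / (6 * (3 - α))))) +
        ((-(L T / 2)) * d ^ 2 + (-(T ^ (-α) / (6 * α))) * d ^ 3) := by
    ext d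
    simp only [mul_inv, div_eq_mul_inv]
    ring
  rw [h2, sandwich_add, sandwich_add _ _ _ _ (fun _ => -(T ^ (3 - α) / (6 * (3 - α)))),
    sandwich_const, sandwich_add _ _ _ (fun d => (-(L T / 2)) * d ^ 2), sandwich_const_mul,
    sandwich_const_mul, sandwich_sq]
  ring

lemma integrableOn_I_mul_rhoInf (hα : α ∈ Ioo (0 : ℝ) 2) :
    IntegrableOn (fun s => M.I s j k * rhoInf α s) (Ioi 0) := by
  obtain ⟨T, hT0, hT⟩ := M.exists_D_lt j k
  rw [← Ioc_union_Ioi_eq_Ioi hT0.le]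
  refine IntegrableOn.union ((intervalIntegrable_iff_integrableOn_Ioc_of_le hT0.le).1
    (M.intervalIntegrable_I_mul_rhoInf j k hα hT)) ?_
  have hi : IntegrableOn (fun s => M.sandwich (fun d => d ^ 3) j k / 6 * Cconst α *
      s ^ (-(1 + α))) (Ioi T) :=
    (integrableOn_Ioi_rpow_of_lt (by linarith [hα.1]) hT0).const_mul _
  refine hi.congr_fun (fun s hs => ?_) measurableSet_Ioi
  have h0 : (0 : ℝ) < s := hT0.trans hs
  simp only
  rw [M.I_of_large j k fun p q => ((hT p q).trans hs).le, rhoInf, Real.rpow_neg h0.le]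
  ring

lemma integral_I_mul_rhoInf_eq_sandwich (hα : α ∈ Ioo (0 : ℝ) 2) {L : ℝ → ℝ}
    (hL : ∀ x, 0 < x → HasDerivAt L (x ^ (-α)) x) :
    ∫ s in Ioi (0 : ℝ), M.I s j k * rhoInf α s =
      Cconst α * M.sandwich (fun d => (-(1 / (2 * (2 - α))) + 1 / (6 * (3 - α)) + 1 / (6 * α)) *
        d ^ (3 - α) + 1 / 2 * (d ^ 2 * L d)) j k := by
  refine tendsto_nhds_unique (intervalIntegral_tendsto_integral_Ioi 0
    (M.integrableOn_I_mul_rhoInf j k hα) tendsto_id) ?_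
  obtain ⟨Z, hZ0, hZ⟩ := M.exists_D_lt j k
  have h := (tendsto_const_nhds (x := Cconst α * M.sandwich (fun d =>
      (-(1 / (2 * (2 - α))) + 1 / (6 * (3 - α)) + 1 / (6 * α)) *
        d ^ (3 - α) + 1 / 2 * (d ^ 2 * L d)) j k)).sub ((tendsto_rpow_neg_atTop hα.1).const_mul
      (Cconst α * M.sandwich (fun d => d ^ 3) j k / (6 * α)))
  rw [mul_zero, sub_zero] at h
  refine h.congr' ?_
  filter_upwards [eventually_ge_atTop Z] with T hT
  exact (M.intervalIntegral_I_mul_rhoInf j k hα (fun p q => (hZ p q).trans_le hT) hL).symm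

lemma integral_I_mul_rhoInf (hα : α ∈ Ioo (0 : ℝ) 2) :
    ∫ s in Ioi (0 : ℝ), M.I s j k * rhoInf α s = M.entry α j k := by
  by_cases h : α = 1
  · subst h
    rw [M.integral_I_mul_rhoInf_eq_sandwich j k hα (L := Real.log) fun x hx => by
        rw [Real.rpow_neg_one]; exact Real.hasDerivAt_log hx.ne', entry, if_pos rfl, Cconst_one,
      sandwich_add, sandwich_const_mul, sandwich_const_mul,
      show (3 : ℝ) - 1 = (2 : ℕ) by norm_num]
    simp only [Real.rpow_natCast]
    rw [sandwich_sq]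
    ring
  · have h1 : 1 - α ≠ 0 := fun h' => h (by linarith)
    have h2 : 2 - α ≠ 0 := by linarith [hα.2]
    have h3 : 3 - α ≠ 0 := by linarith [hα.2]
    have h0 := hα.1.ne'
    rw [M.integral_I_mul_rhoInf_eq_sandwich j k hα (L := fun x => x ^ (1 - α) / (1 - α))
      fun x hx => by
        convert! (Real.hasDerivAt_rpow_const (p := 1 - α) (Or.inl hx.ne')).div_const (1 - α) using 1
        rw [show 1 - α - 1 = -α by ring]
        field_simp, entry, if_neg h, ← Cconst_mul_cos hα h, div_mul_eq_mul_div, mul_div_assoc]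
    congr 1
    rw [div_eq_inv_mul (M.sandwich _ j k), ← sandwich_const_mul]
    refine M.sandwich_congr j k fun p q => ?_
    have hd := M.D_nonneg j k p q
    generalize M.D j k p q = d at hd
    -- The distance may be zero; the splitting still holds because the total exponent is nonzero.
    have : d ^ (3 - α) = d ^ 2 * d ^ (1 - α) := by
      rw [show 3 - α = (2 : ℕ) + (1 - α) by push_cast; ring,
        Real.rpow_add' hd (by push_cast; intro h; exact h3 (by linarith)), Real.rpow_natCast]
    rw [this]
    -- The four coefficients are the partial fractions of `1 / (α (1-α) (2-α) (3-α))`.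
    field_simp
    ring

end Mesh

/-! ### Energy form and truncated stiffness matrices. -/

lemma integrable_comp_abs {f : ℝ → ℝ} (hf : IntegrableOn f (Ioi 0)) :
    Integrable fun x => f |x| := by
  rw [← integrableOn_univ, ← Iic_union_Ioi (a := (0 : ℝ))]
  refine IntegrableOn.union ?_ (hf.congr_fun (fun x hx => ?_) measurableSet_Ioi)
  · rw [integrableOn_Iic_iff_integrableOn_Iio]
    have := hf.comp_neg
    rw [neg_Ioi, neg_zero] at this
    refine this.congr_fun (fun x hx => ?_) measurableSet_Iio
    simp only [abs_of_neg (show x < 0 from hx)]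
  · simp only [abs_of_pos (show 0 < x from hx)]

lemma rhoInf_nonneg {α s : ℝ} (hα : α ∈ Ioo (0 : ℝ) 2) (hs : 0 ≤ s) : 0 ≤ rhoInf α s :=
  div_nonneg (Cconst_pos hα).le (Real.rpow_nonneg hs _)

lemma measurable_rhoInf (α : ℝ) : Measurable (rhoInf α) := by
  unfold rhoInf
  fun_prop

namespace Mesh

variable {a b : ℝ} {N : ℕ} (M : Mesh a b N) (j k : Fin N) {α : ℝ}

/-- The energy density in the variables `(t, s) = (x, y - x)`. -/
noncomputable def stepDensity (α : ℝ) (p : ℝ × ℝ) : ℝ :=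
  M.hatDiff j p.2 p.1 * M.hatDiff k p.2 p.1 * rhoInf α |p.2|

lemma measurable_stepDensity : Measurable (M.stepDensity j k α) := by
  have h : ∀ i, Measurable fun p : ℝ × ℝ => M.hatDiff i p.2 p.1 := fun i =>
    (((M.continuous_hat i).comp (continuous_fst.add continuous_snd)).sub
      ((M.continuous_hat i).comp continuous_fst)).measurable
  exact ((h j).mul (h k)).mul ((measurable_rhoInf α).comp (measurable_snd.abs))

lemma integrable_I_mul_rhoInf_abs (hα : α ∈ Ioo (0 : ℝ) 2) :
    Integrable fun s => M.I s j k * rhoInf α |s| := by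
  simpa only [I_abs] using integrable_comp_abs (M.integrableOn_I_mul_rhoInf j k hα)

lemma integral_I_mul_rhoInf_abs (hα : α ∈ Ioo (0 : ℝ) 2) :
    ∫ s, M.I s j k * rhoInf α |s| = 2 * M.entry α j k := by
  have := integral_comp_abs (f := fun s => M.I s j k * rhoInf α s)
  simp only [I_abs] at this
  rw [this, M.integral_I_mul_rhoInf j k hα]

lemma integral_stepDensity_left (s : ℝ) :
    ∫ t, M.stepDensity j k α (t, s) = M.I s j k * rhoInf α |s| := by
  simp only [stepDensity]
  rw [integral_mul_const, integral_hatDiff_mul]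

lemma integrable_stepDensity_self (hα : α ∈ Ioo (0 : ℝ) 2) :
    Integrable (M.stepDensity j j α) (volume.prod volume) := by
  rw [integrable_prod_iff' (M.measurable_stepDensity j j).aestronglyMeasurable]
  refine ⟨Eventually.of_forall fun s => (M.integrable_hatDiff_mul j j s).mul_const (rhoInf α |s|), ?_⟩
  have : ∀ p, ‖M.stepDensity j j α p‖ = M.stepDensity j j α p := fun p =>
    Real.norm_of_nonneg (mul_nonneg (mul_self_nonneg _) (rhoInf_nonneg hα (abs_nonneg _)))
  simp only [this, integral_stepDensity_left]
  exact M.integrable_I_mul_rhoInf_abs j j hα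

/-- Domination by the diagonal densities, from `|uv| ≤ u² + v²`. -/
lemma integrable_stepDensity (hα : α ∈ Ioo (0 : ℝ) 2) :
    Integrable (M.stepDensity j k α) (volume.prod volume) := by
  refine ((M.integrable_stepDensity_self j hα).add (M.integrable_stepDensity_self k hα)).mono'
    (M.measurable_stepDensity j k).aestronglyMeasurable (Eventually.of_forall fun p => ?_)
  have h := rhoInf_nonneg hα (abs_nonneg p.2)
  simp only [stepDensity, Pi.add_apply]
  rw [Real.norm_eq_abs, abs_mul, abs_of_nonneg h, ← add_mul]
  refine mul_le_mul_of_nonneg_right ?_ h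
  rw [abs_le]
  constructor <;> nlinarith [sq_nonneg (M.hatDiff j p.2 p.1 + M.hatDiff k p.2 p.1),
    sq_nonneg (M.hatDiff j p.2 p.1 - M.hatDiff k p.2 p.1), mul_self_nonneg (M.hatDiff j p.2 p.1),
    mul_self_nonneg (M.hatDiff k p.2 p.1)]

lemma integral_stepDensity (hα : α ∈ Ioo (0 : ℝ) 2) :
    ∫ p, M.stepDensity j k α p = 2 * M.entry α j k := by
  rw [Measure.volume_eq_prod, integral_prod_symm _ (M.integrable_stepDensity j k hα)]
  simp only [integral_stepDensity_left]
  exact M.integral_I_mul_rhoInf_abs j k hα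

lemma energyDensity_shear (p : ℝ × ℝ) :
    M.energyDensity α j k (p.1, p.1 + p.2) = M.stepDensity j k α p := by
  simp only [energyDensity, stepDensity, hatDiff, rhoInf]
  rw [show p.1 - (p.1 + p.2) = -p.2 by ring, abs_neg]
  ring

lemma integrable_energyDensity (hα : α ∈ Ioo (0 : ℝ) 2) : Integrable (M.energyDensity α j k) := by
  rw [Measure.volume_eq_prod, ← (measurePreserving_prod_add volume volume).integrable_comp_emb
    (MeasurableEquiv.shearAddRight ℝ).measurableEmbedding]
  exact (M.integrable_stepDensity j k hα).congr
    (Eventually.of_forall fun p => (M.energyDensity_shear j k p).symm)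

lemma fracStiffness_eq_entry (hα : α ∈ Ioo (0 : ℝ) 2) :
    M.fracStiffness α j k = M.entry α j k := by
  rw [fracStiffness, Matrix.of_apply, Measure.volume_eq_prod,
    ← (measurePreserving_prod_add volume volume).integral_comp
    (MeasurableEquiv.shearAddRight ℝ).measurableEmbedding]
  simp only [energyDensity_shear]
  rw [← Measure.volume_eq_prod, M.integral_stepDensity j k hα]
  ring

lemma stiffness_rhoTrunc (hα : α ∈ Ioo (0 : ℝ) 2) {δ : ℝ} (hδ : 0 < δ) :
    M.stiffness (rhoTrunc α δ) δ j k =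
      1 / 2 * ∫ s in (-δ)..δ, M.I s j k * rhoInf α |s| := by
  have hle : -δ ≤ δ := by linarith
  have h1 : ∀ t, ∫ s in (-δ)..δ, (M.hat j (t + s) - M.hat j t) * (M.hat k (t + s) - M.hat k t) *
      rhoTrunc α δ |s| = ∫ s in Ioc (-δ) δ, M.stepDensity j k α (t, s) := by
    intro t
    rw [intervalIntegral.integral_of_le hle]
    refine setIntegral_congr_ae measurableSet_Ioc ?_
    -- The truncated kernel vanishes at `s = 0` and `|s| = δ`, where `stepDensity` need not; these
    -- are null sets.
    filter_upwards [compl_mem_ae_iff.2 (measure_singleton (0 : ℝ)),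
      compl_mem_ae_iff.2 (measure_singleton δ)] with s h0 hδ' hs
    have : |s| ∈ Ioo 0 δ := ⟨abs_pos.2 h0, abs_lt.2 ⟨hs.1, lt_of_le_of_ne hs.2 hδ'⟩⟩
    rw [rhoTrunc, indicator_of_mem this]
    rfl
  have h2 : Integrable (Function.uncurry fun t s => M.stepDensity j k α (t, s))
      (volume.prod (volume.restrict (Ioc (-δ) δ))) := by
    refine (M.integrable_stepDensity j k hα).mono_measure ?_
    exact Measure.prod_mono le_rfl Measure.restrict_le_self
  rw [stiffness, Matrix.of_apply]
  simp only [h1]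
  rw [integral_integral_swap h2, intervalIntegral.integral_of_le hle]
  simp only [integral_stepDensity_left]

lemma tendsto_stiffness (hα : α ∈ Ioo (0 : ℝ) 2) :
    Tendsto (fun δ : ℝ => M.stiffness (rhoTrunc α δ) δ j k) atTop (𝓝 (M.entry α j k)) := by
  have h := (intervalIntegral_tendsto_integral (M.integrable_I_mul_rhoInf_abs j k hα)
    tendsto_neg_atTop_atBot tendsto_id).const_mul (1 / 2)
  rw [M.integral_I_mul_rhoInf_abs j k hα, one_div, inv_mul_cancel_left₀ two_ne_zero] at h
  refine h.congr' ?_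
  filter_upwards [eventually_gt_atTop 0] with δ hδ
  rw [M.stiffness_rhoTrunc j k hα hδ, one_div]
  rfl

end Mesh

/-! ### The Lévy–Khintchine formula for `|ξ|^α`. -/

section LevyKhintchine

variable {α : ℝ}

/-- The quadratic bound controls the origin because `α < 2`, the uniform bound controls infinity
because `α > 0`. -/
lemma integrableOn_div_rpow (hα : α ∈ Ioo (0 : ℝ) 2) {φ : ℝ → ℝ} (hm : Measurable φ) {A B : ℝ}
    (hA : ∀ s, |φ s| ≤ A * s ^ 2) (hB : ∀ s, |φ s| ≤ B) :
    IntegrableOn (fun s => φ s / s ^ (1 + α)) (Ioi 0) := by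
  have hmeas : Measurable fun s => φ s / s ^ (1 + α) := by fun_prop
  rw [← Ioc_union_Ioi_eq_Ioi zero_le_one]
  refine IntegrableOn.union ?_ ?_
  · have h : IntegrableOn (fun s : ℝ => A * s ^ (1 - α)) (Ioc 0 1) :=
      ((intervalIntegrable_iff_integrableOn_Ioc_of_le zero_le_one).1
        (intervalIntegral.intervalIntegrable_rpow' (by linarith [hα.2]))).const_mul A
    refine h.mono' hmeas.aestronglyMeasurable ?_
    filter_upwards [ae_restrict_mem measurableSet_Ioc] with s hs
    have hp := Real.rpow_pos_of_pos hs.1 (1 + α)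
    rw [Real.norm_eq_abs, abs_div, abs_of_pos hp, div_le_iff₀ hp, mul_assoc,
      ← Real.rpow_add hs.1, show 1 - α + (1 + α) = (2 : ℕ) by push_cast; ring, Real.rpow_natCast]
    exact hA s
  · have h : IntegrableOn (fun s : ℝ => B * s ^ (-(1 + α))) (Ioi 1) :=
      (integrableOn_Ioi_rpow_of_lt (by linarith [hα.1]) zero_lt_one).const_mul B
    refine h.mono' hmeas.aestronglyMeasurable ?_
    filter_upwards [ae_restrict_mem measurableSet_Ioi] with s hs
    have h0 : (0 : ℝ) < s := zero_lt_one.trans hs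
    have hp := Real.rpow_pos_of_pos h0 (1 + α)
    rw [Real.norm_eq_abs, abs_div, abs_of_pos hp, Real.rpow_neg h0.le, div_eq_mul_inv]
    exact mul_le_mul_of_nonneg_right (hB s) (inv_nonneg.2 hp.le)

lemma integrableOn_one_sub_cos_div (hα : α ∈ Ioo (0 : ℝ) 2) (ξ : ℝ) :
    IntegrableOn (fun s => (1 - Real.cos (s * ξ)) / s ^ (1 + α)) (Ioi 0) := by
  refine integrableOn_div_rpow hα (by fun_prop) (A := ξ ^ 2 / 2) (B := 2) (fun s => ?_) fun s => ?_
  · rw [abs_of_nonneg (by linarith [Real.cos_le_one (s * ξ)])]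
    nlinarith [Real.one_sub_sq_div_two_le_cos (x := s * ξ)]
  · rw [abs_le]
    constructor <;> linarith [Real.cos_le_one (s * ξ), Real.neg_one_le_cos (s * ξ)]

lemma integrableOn_one_sub_exp_div (hα : α ∈ Ioo (0 : ℝ) 2) :
    IntegrableOn (fun s => (1 - Real.exp (-(s ^ 2 / 4))) / s ^ (1 + α)) (Ioi 0) := by
  have h1 : ∀ s : ℝ, Real.exp (-(s ^ 2 / 4)) ≤ 1 := fun s =>
    Real.exp_le_one_iff.2 (by nlinarith [sq_nonneg s])
  refine integrableOn_div_rpow hα (by fun_prop) (A := 1 / 4) (B := 1) (fun s => ?_) fun s => ?_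
  · rw [abs_of_nonneg (by linarith [h1 s])]
    linarith [Real.add_one_le_exp (-(s ^ 2 / 4))]
  · rw [abs_of_nonneg (by linarith [h1 s])]
    linarith [Real.exp_pos (-(s ^ 2 / 4))]

lemma integral_one_sub_cos_mul_div (hα : α ∈ Ioo (0 : ℝ) 2) (ξ : ℝ) :
    ∫ s in Ioi (0 : ℝ), (1 - Real.cos (s * ξ)) / s ^ (1 + α) =
      |ξ| ^ α * ∫ s in Ioi (0 : ℝ), (1 - Real.cos s) / s ^ (1 + α) := by
  rcases eq_or_ne ξ 0 with rfl | hξ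
  · simp [Real.zero_rpow hα.1.ne']
  have hb : 0 < |ξ| := abs_pos.2 hξ
  have h := integral_comp_mul_left_Ioi (fun s : ℝ => (1 - Real.cos s) / s ^ (1 + α)) 0 hb
  rw [mul_zero, smul_eq_mul] at h
  have e : ∫ s in Ioi (0 : ℝ), (1 - Real.cos (|ξ| * s)) / (|ξ| * s) ^ (1 + α) =
      (|ξ| ^ (1 + α))⁻¹ * ∫ s in Ioi (0 : ℝ), (1 - Real.cos (s * ξ)) / s ^ (1 + α) := by
    rw [← integral_const_mul]
    refine setIntegral_congr_fun measurableSet_Ioi fun s hs => ?_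
    have hs0 : (0 : ℝ) < s := hs
    rw [Real.mul_rpow hb.le hs0.le, ← Real.cos_abs (s * ξ), abs_mul, abs_of_pos hs0,
      mul_comm s |ξ|, div_mul_eq_div_div]
    ring
  rw [e, Real.rpow_one_add' hb.le (by linarith [hα.1]), mul_inv, mul_assoc] at h
  have h' := mul_left_cancel₀ (inv_ne_zero hb.ne') h
  rw [← h', mul_inv_cancel_left₀ (Real.rpow_pos_of_pos hb α).ne']

lemma integral_exp_neg_sq_mul_cos (s : ℝ) :
    ∫ ξ : ℝ, Real.exp (-ξ ^ 2) * Real.cos (s * ξ) =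
      √Real.pi * Real.exp (-(s ^ 2 / 4)) := by
  have h := fourierIntegral_gaussian (b := 1) (by simp) s
  have e1 : ∀ x : ℝ, Complex.exp (Complex.I * s * x) * Complex.exp (-1 * (x : ℂ) ^ 2) =
      ((Real.exp (-x ^ 2) : ℝ) : ℂ) * Complex.exp (((s * x : ℝ) : ℂ) * Complex.I) := by
    intro x
    push_cast
    rw [mul_comm]
    ring_nf
  have e2 : ((Real.pi : ℂ) / 1) ^ (1 / 2 : ℂ) * Complex.exp (-(s : ℂ) ^ 2 / (4 * 1)) =
      ((√Real.pi * Real.exp (-(s ^ 2 / 4)) : ℝ) : ℂ) := by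
    rw [Real.sqrt_eq_rpow, Complex.ofReal_mul, Complex.ofReal_cpow Real.pi_pos.le]
    push_cast
    ring_nf
  simp only [e1] at h
  rw [e2] at h
  have hi : Integrable fun x : ℝ =>
      ((Real.exp (-x ^ 2) : ℝ) : ℂ) * Complex.exp (((s * x : ℝ) : ℂ) * Complex.I) := by
    have hg : Integrable fun x : ℝ => Real.exp (-x ^ 2) := by
      simpa using integrable_exp_neg_mul_sq (b := 1) one_pos
    refine hg.mono' (by fun_prop) (Eventually.of_forall fun x => ?_)
    rw [norm_mul, Complex.norm_exp_ofReal_mul_I, mul_one, Complex.norm_real,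
      Real.norm_of_nonneg (Real.exp_pos _).le]
  have h3 := integral_re hi
  simp only [RCLike.re_eq_complex_re, Complex.re_ofReal_mul, Complex.exp_ofReal_mul_I_re] at h3
  rw [h3, h, Complex.ofReal_re]

lemma integrable_rpow_mul_exp_neg_sq (hα : α ∈ Ioo (0 : ℝ) 2) :
    Integrable (fun ξ : ℝ => |ξ| ^ α * Real.exp (-ξ ^ 2)) ∧
      ∫ ξ : ℝ, |ξ| ^ α * Real.exp (-ξ ^ 2) = Real.Gamma ((1 + α) / 2) := by
  have h1 := integrableOn_rpow_mul_exp_neg_rpow (p := 2) (s := α) (by linarith [hα.1])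
    (by norm_num)
  have h2 := integral_rpow_mul_exp_neg_rpow (p := 2) (q := α) (by norm_num) (by linarith [hα.1])
  have h3 := integrable_comp_abs h1
  have h4 := integral_comp_abs (f := fun x => x ^ α * Real.exp (-x ^ (2 : ℝ)))
  simp only [Real.rpow_two, sq_abs] at h2 h3 h4
  refine ⟨h3, ?_⟩
  rw [h4, h2, add_comm]
  ring

/-- Integration by parts against `-s^(-α) / α` leaves a Gamma integral. The boundary terms vanish:
the bracket is at most `s² / 4` near `0` and at most `1` at infinity. -/
lemma integral_one_sub_exp_div (hα : α ∈ Ioo (0 : ℝ) 2) :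
    ∫ s in Ioi (0 : ℝ), (1 - Real.exp (-(s ^ 2 / 4))) / s ^ (1 + α) =
      2 ^ (-α) * Real.Gamma (1 - α / 2) / α := by
  have hα0 := hα.1.ne'
  have hi1 := integrableOn_one_sub_exp_div hα
  have hi2 : IntegrableOn (fun s : ℝ => s ^ (1 - α) * Real.exp (-(1 / 4) * s ^ (2 : ℝ))) (Ioi 0) :=
    integrableOn_rpow_mul_exp_neg_mul_rpow (by linarith [hα.2]) (by norm_num) (by norm_num)
  have hv := integral_rpow_mul_exp_neg_mul_rpow (p := 2) (q := 1 - α) (b := 1 / 4)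
    (by norm_num) (by linarith [hα.2]) (by norm_num)
  have hd : ∀ s ∈ Ioi (0 : ℝ), HasDerivAt
      (fun s => -((1 - Real.exp (-(s ^ 2 / 4))) * s ^ (-α)) / α)
      ((1 - Real.exp (-(s ^ 2 / 4))) / s ^ (1 + α) -
        1 / (2 * α) * (s ^ (1 - α) * Real.exp (-(1 / 4) * s ^ (2 : ℝ)))) s := by
    intro s hs
    have hs0 : (0 : ℝ) < s := hs
    have hq : HasDerivAt (fun s : ℝ => -(s ^ 2 / 4)) (-(s / 2)) s := by
      convert! ((hasDerivAt_pow 2 s).div_const 4).neg using 1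
      norm_num
      ring
    convert! ((((hq.exp.const_sub 1).mul
      (Real.hasDerivAt_rpow_const (p := -α) (Or.inl hs0.ne')))).neg).div_const α using 1
    have e1 : s ^ (1 - α) = s * s ^ (-α) := by
      rw [sub_eq_add_neg, Real.rpow_add hs0, Real.rpow_one]
    have e2 : (s ^ (1 + α))⁻¹ = s ^ (-α - 1) := by
      rw [← Real.rpow_neg hs0.le]; ring_nf
    rw [div_eq_mul_inv, e1, e2, Real.rpow_two, show -(1 / 4) * s ^ 2 = -(s ^ 2 / 4) by ring]
    field_simp
    ring
  have hle : ∀ s : ℝ, 0 ≤ 1 - Real.exp (-(s ^ 2 / 4)) := fun s =>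
    sub_nonneg.2 (Real.exp_le_one_iff.2 (by nlinarith [sq_nonneg s]))
  have hc : ContinuousWithinAt (fun s : ℝ => -((1 - Real.exp (-(s ^ 2 / 4))) * s ^ (-α)) / α)
      (Ici 0) 0 := by
    rw [← continuousWithinAt_Ioi_iff_Ici, ContinuousWithinAt]
    have h0 : -((1 - Real.exp (-((0 : ℝ) ^ 2 / 4))) * 0 ^ (-α)) / α = 0 := by simp
    rw [h0]
    have hlim : Tendsto (fun s : ℝ => s ^ (2 - α) / (4 * α)) (𝓝[>] 0) (𝓝 0) := by
      have : Tendsto (fun s : ℝ => s ^ (2 - α)) (𝓝[>] 0) (𝓝 0) := by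
        have := (Real.continuousAt_rpow_const 0 (2 - α) (Or.inr (by linarith [hα.2]))).tendsto
        rw [Real.zero_rpow (by linarith [hα.2])] at this
        exact this.mono_left nhdsWithin_le_nhds
      simpa using this.div_const (4 * α)
    refine squeeze_zero_norm' ?_ hlim
    filter_upwards [self_mem_nhdsWithin] with s hs
    have hs0 : (0 : ℝ) < s := hs
    have hp := Real.rpow_pos_of_pos hs0 (-α)
    rw [Real.norm_eq_abs, abs_div, abs_neg, abs_mul, abs_of_nonneg (hle s), abs_of_pos hp,
      abs_of_pos hα.1, show s ^ (2 - α) = s ^ 2 * s ^ (-α) by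
        rw [sub_eq_add_neg, Real.rpow_add hs0, Real.rpow_two], ← div_div]
    refine div_le_div_of_nonneg_right ?_ hα.1.le
    have := mul_le_mul_of_nonneg_right (show 1 - Real.exp (-(s ^ 2 / 4)) ≤ s ^ 2 / 4 by
      linarith [Real.add_one_le_exp (-(s ^ 2 / 4))]) hp.le
    linarith
  have hinf : Tendsto (fun s : ℝ => -((1 - Real.exp (-(s ^ 2 / 4))) * s ^ (-α)) / α) atTop
      (𝓝 0) := by
    have hlim : Tendsto (fun s : ℝ => s ^ (-α) / α) atTop (𝓝 0) := by
      simpa using (tendsto_rpow_neg_atTop hα.1).div_const α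
    refine squeeze_zero_norm' ?_ hlim
    filter_upwards [eventually_gt_atTop 0] with s hs0
    have hp := Real.rpow_pos_of_pos hs0 (-α)
    rw [Real.norm_eq_abs, abs_div, abs_neg, abs_mul, abs_of_nonneg (hle s), abs_of_pos hp,
      abs_of_pos hα.1]
    refine div_le_div_of_nonneg_right ?_ hα.1.le
    exact mul_le_of_le_one_left hp.le (by linarith [Real.exp_pos (-(s ^ 2 / 4))])
  have key := integral_Ioi_of_hasDerivAt_of_tendsto hc hd (hi1.sub (hi2.const_mul (1 / (2 * α))))
    hinf
  rw [integral_sub hi1 (hi2.const_mul _), integral_const_mul, hv] at key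
  have h4 : (1 / 4 : ℝ) ^ (-(1 - α + 1) / 2) = 4 * 2 ^ (-α) := by
    rw [show (1 / 4 : ℝ) = 2 ^ (-2 : ℝ) by rw [Real.rpow_neg two_pos.le]; norm_num,
      ← Real.rpow_mul two_pos.le, show -2 * (-(1 - α + 1) / 2) = 2 + -α by ring,
      Real.rpow_add two_pos]
    norm_num
  rw [h4, show (1 - α + 1) / 2 = 1 - α / 2 by ring] at key
  simp only [ne_eq, OfNat.ofNat_ne_zero, not_false_eq_true, zero_pow, zero_div, neg_zero,
    Real.exp_zero, sub_self, zero_mul] at key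
  rw [sub_eq_zero.1 key]
  generalize Real.Gamma (1 - α / 2) = A
  field_simp
  norm_num

/-- The scaling law in `ξ` is averaged against `exp (-ξ²)`. One order of integration yields the
Gamma factor times the unknown integral; the other turns the cosine into a Gaussian in `s`. -/
lemma integral_one_sub_cos_div (hα : α ∈ Ioo (0 : ℝ) 2) :
    Real.Gamma ((1 + α) / 2) * ∫ s in Ioi (0 : ℝ), (1 - Real.cos s) / s ^ (1 + α) =
      √Real.pi * (2 ^ (-α) * Real.Gamma (1 - α / 2) / α) := by
  obtain ⟨hgi, hgv⟩ := integrable_rpow_mul_exp_neg_sq hα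
  rw [← hgv, ← integral_mul_const, ← integral_one_sub_exp_div hα, ← integral_const_mul]
  have hint : Integrable (Function.uncurry fun ξ s : ℝ =>
      Real.exp (-ξ ^ 2) * ((1 - Real.cos (s * ξ)) / s ^ (1 + α)))
      (volume.prod (volume.restrict (Ioi 0))) := by
    have hm : Measurable (Function.uncurry fun ξ s : ℝ =>
      Real.exp (-ξ ^ 2) * ((1 - Real.cos (s * ξ)) / s ^ (1 + α))) := by
      unfold Function.uncurry
      fun_prop
    rw [integrable_prod_iff hm.aestronglyMeasurable]
    refine ⟨Eventually.of_forall fun ξ => (integrableOn_one_sub_cos_div hα ξ).const_mul (Real.exp (-ξ ^ 2)),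
      ?_⟩
    refine (hgi.mul_const (∫ s in Ioi (0 : ℝ), (1 - Real.cos s) / s ^ (1 + α))).congr
      (Eventually.of_forall fun ξ => ?_)
    simp only [Function.uncurry]
    rw [mul_right_comm, ← integral_one_sub_cos_mul_div hα, mul_comm, ← integral_const_mul]
    refine setIntegral_congr_fun measurableSet_Ioi fun s hs => ?_
    refine (Real.norm_of_nonneg (mul_nonneg (Real.exp_pos _).le (div_nonneg ?_
      (Real.rpow_nonneg (le_of_lt hs) _)))).symm
    linarith [Real.cos_le_one (s * ξ)]
  have hsw := integral_integral_swap hint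
  have e1 : ∀ ξ : ℝ, ∫ s in Ioi (0 : ℝ), Real.exp (-ξ ^ 2) * ((1 - Real.cos (s * ξ)) / s ^ (1 + α))
      = |ξ| ^ α * Real.exp (-ξ ^ 2) * ∫ s in Ioi (0 : ℝ), (1 - Real.cos s) / s ^ (1 + α) := by
    intro ξ
    rw [integral_const_mul, integral_one_sub_cos_mul_div hα]
    ring
  simp only [e1] at hsw
  rw [hsw]
  congr 1
  ext s
  have hg1 : Integrable fun ξ : ℝ => Real.exp (-ξ ^ 2) := by
    simpa using integrable_exp_neg_mul_sq (b := 1) one_pos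
  have hg2 : Integrable fun ξ : ℝ => Real.exp (-ξ ^ 2) * Real.cos (s * ξ) := by
    refine hg1.mono' (by fun_prop) (Eventually.of_forall fun ξ => ?_)
    rw [Real.norm_eq_abs, abs_mul, abs_of_pos (Real.exp_pos _)]
    exact mul_le_of_le_one_right (Real.exp_pos _).le (Real.abs_cos_le_one _)
  have e2 : ∀ ξ : ℝ, Real.exp (-ξ ^ 2) * ((1 - Real.cos (s * ξ)) / s ^ (1 + α)) =
      (Real.exp (-ξ ^ 2) - Real.exp (-ξ ^ 2) * Real.cos (s * ξ)) / s ^ (1 + α) := fun ξ => by ring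
  simp only [e2]
  rw [integral_div, integral_sub hg1 hg2, integral_exp_neg_sq_mul_cos]
  have : ∫ ξ : ℝ, Real.exp (-ξ ^ 2) = √Real.pi := by
    simpa using integral_gaussian 1
  rw [this]
  ring

/-- The symbol of the fractional Laplacian as a Lévy–Khintchine integral. -/
lemma integral_two_mul_one_sub_cos_mul_rhoInf (hα : α ∈ Ioo (0 : ℝ) 2) (ξ : ℝ) :
    IntegrableOn (fun s => 2 * (1 - Real.cos (s * ξ)) * rhoInf α s) (Ioi 0) ∧
      ∫ s in Ioi (0 : ℝ), 2 * (1 - Real.cos (s * ξ)) * rhoInf α s = |ξ| ^ α := by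
  have e : ∀ s, 2 * (1 - Real.cos (s * ξ)) * rhoInf α s =
      2 * Cconst α * ((1 - Real.cos (s * ξ)) / s ^ (1 + α)) := by
    intro s
    unfold rhoInf
    ring
  simp only [e]
  refine ⟨(integrableOn_one_sub_cos_div hα ξ).const_mul _, ?_⟩
  rw [integral_const_mul, integral_one_sub_cos_mul_div hα]
  -- What remains is that `2 C_α` times the integral of `(1 - cos s) / s^(1+α)` equals `1`.
  have hK := integral_one_sub_cos_div hα
  have h1 := (Real.Gamma_pos_of_pos (show 0 < (1 + α) / 2 by linarith [hα.1])).ne'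
  have h2 := (Real.Gamma_pos_of_pos (show 0 < 1 - α / 2 by linarith [hα.2])).ne'
  rw [mul_comm, ← eq_div_iff h1] at hK
  rw [hK, Cconst, Real.rpow_sub_one two_ne_zero, Real.rpow_neg two_pos.le]
  generalize Real.Gamma (1 - α / 2) = A at *
  generalize Real.Gamma ((1 + α) / 2) = B at *
  have := hα.1.ne'
  field_simp

end LevyKhintchine

/-! ### Plancherel for integrable functions and the unitary normalisation. -/

section Fourier

open scoped FourierTransform ComplexConjugate

/-- The transform of `h` is moved by adjointness onto `𝓕 f`, where it becomes the inverse transform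
and returns `f`. -/
lemma integral_fourier_mul_conj_fourier {f h : ℝ → ℂ} (hf : Integrable f) (hfc : Continuous f)
    (hf' : Integrable (𝓕 f)) (hh : Integrable h) :
    ∫ η, 𝓕 f η * conj (𝓕 h η) = ∫ t, f t * conj (h t) := by
  have key := VectorFourier.integral_sesq_fourierIntegral_eq_neg_flip (innerSL ℂ)
    (L := innerₗ ℝ) (μ := volume) (ν := volume) Real.continuous_fourierChar continuous_inner hh hf'
  have e : ∀ x, VectorFourier.fourierIntegral Real.fourierChar volume (-(innerₗ ℝ).flip) (𝓕 f) x =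
      f x := by
    intro x
    rw [← congrFun (hfc.fourierInv_fourier_eq hf hf') x, Real.fourierInv_eq]
    simp [VectorFourier.fourierIntegral]
  simp only [e] at key
  exact key

lemma fourierU_eq_fourier (u : ℝ → ℝ) (ξ : ℝ) :
    fourierU u ξ = ((1 / √(2 * Real.pi) : ℝ) : ℂ) *
      𝓕 (fun t => (u t : ℂ)) (ξ / (2 * Real.pi)) := by
  rw [fourierU, Real.fourier_real_eq_integral_exp_smul]
  congr 2
  ext t
  rw [smul_eq_mul]
  congr 2
  have := Real.pi_pos.ne'
  rw [show -2 * Real.pi * t * (ξ / (2 * Real.pi)) = -(t * ξ) by field_simp]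
  push_cast
  ring

/-- Plancherel's identity for the unitary Fourier transform. -/
lemma integral_fourierU_mul_star {u v : ℝ → ℝ} (hu : Integrable u) (huc : Continuous u)
    (hu' : Integrable (fourierU u)) (hv : Integrable v) :
    ∫ ξ, fourierU u ξ * star (fourierU v ξ) = ((∫ t, u t * v t : ℝ) : ℂ) := by
  have hpi : 2 * Real.pi ≠ 0 := by positivity
  have hc : ((1 / √(2 * Real.pi) : ℝ) : ℂ) ≠ 0 := by
    rw [Complex.ofReal_ne_zero]
    positivity
  have hF : Integrable (𝓕 fun t => (u t : ℂ)) := by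
    have h1 : Integrable fun ξ => 𝓕 (fun t => (u t : ℂ)) (ξ / (2 * Real.pi)) := by
      refine (hu'.const_mul (((1 / √(2 * Real.pi) : ℝ) : ℂ)⁻¹)).congr
        (Eventually.of_forall fun ξ => ?_)
      simp only
      rw [fourierU_eq_fourier, inv_mul_cancel_left₀ hc]
    have h2 := h1.comp_mul_right' hpi
    simpa only [mul_div_cancel_right₀ _ hpi] using h2
  have hP := integral_fourier_mul_conj_fourier (f := fun t => (u t : ℂ)) (h := fun t => (v t : ℂ))
    hu.ofReal (by fun_prop) hF hv.ofReal
  have e : ∀ ξ, fourierU u ξ * star (fourierU v ξ) = ((1 / (2 * Real.pi) : ℝ) : ℂ) *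
      (fun η => 𝓕 (fun t => (u t : ℂ)) η * conj (𝓕 (fun t => (v t : ℂ)) η))
        (ξ / (2 * Real.pi)) := by
    intro ξ
    have h2 : ((1 / √(2 * Real.pi) : ℝ) : ℂ) * ((1 / √(2 * Real.pi) : ℝ) : ℂ) =
        ((1 / (2 * Real.pi) : ℝ) : ℂ) := by
      rw [← Complex.ofReal_mul, div_mul_div_comm, one_mul, Real.mul_self_sqrt (by positivity)]
    rw [fourierU_eq_fourier, fourierU_eq_fourier, star_mul', Complex.star_def,
      Complex.conj_ofReal, ← h2]
    ring
  simp only [e]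
  rw [integral_const_mul, Measure.integral_comp_div
    (fun η => 𝓕 (fun t => (u t : ℂ)) η * conj (𝓕 (fun t => (v t : ℂ)) η)), hP,
    abs_of_pos (by positivity), Complex.real_smul, ← mul_assoc, ← Complex.ofReal_mul,
    one_div_mul_cancel hpi, Complex.ofReal_one, one_mul, ← integral_complex_ofReal]
  simp

lemma norm_exp_neg_I_mul (t ξ : ℝ) : ‖Complex.exp (-Complex.I * t * ξ)‖ = 1 := by
  rw [show -Complex.I * t * ξ = ((-(t * ξ) : ℝ) : ℂ) * Complex.I by push_cast; ring,
    Complex.norm_exp_ofReal_mul_I]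

lemma continuous_fourierU {u : ℝ → ℝ} (hu : Integrable u) : Continuous (fourierU u) := by
  refine continuous_const.mul ?_
  refine continuous_of_dominated (bound := fun t => ‖u t‖) (fun ξ => ?_) (fun ξ => ?_) hu.norm ?_
  · exact (Continuous.aestronglyMeasurable (by fun_prop)).mul
      hu.ofReal.aestronglyMeasurable
  · refine Eventually.of_forall fun t => ?_
    rw [norm_mul, norm_exp_neg_I_mul, one_mul, Complex.norm_real]
  · exact Eventually.of_forall fun t => by fun_prop

lemma norm_fourierU_le (u : ℝ → ℝ) (ξ : ℝ) :
    ‖fourierU u ξ‖ ≤ 1 / √(2 * Real.pi) * ∫ t, ‖u t‖ := by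
  rw [fourierU, norm_mul, Complex.norm_real, Real.norm_of_nonneg (by positivity)]
  refine mul_le_mul_of_nonneg_left ((norm_integral_le_integral_norm _).trans_eq ?_) (by positivity)
  congr 1
  ext t
  rw [norm_mul, norm_exp_neg_I_mul, one_mul, Complex.norm_real]

lemma integrable_exp_mul {u : ℝ → ℝ} (hu : Integrable u) (ξ : ℝ) :
    Integrable fun t : ℝ => Complex.exp (-Complex.I * t * ξ) * ((u t : ℝ) : ℂ) := by
  refine hu.norm.mono' ((Continuous.aestronglyMeasurable (by fun_prop)).mul
    hu.ofReal.aestronglyMeasurable) (Eventually.of_forall fun t => ?_)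
  rw [norm_mul, norm_exp_neg_I_mul, one_mul, Complex.norm_real]

lemma fourierU_comp_add_sub {u : ℝ → ℝ} (hu : Integrable u) (s ξ : ℝ) :
    fourierU (fun t => u (t + s) - u t) ξ =
      (Complex.exp (((s * ξ : ℝ) : ℂ) * Complex.I) - 1) * fourierU u ξ := by
  have h1 : ∫ t : ℝ, Complex.exp (-Complex.I * t * ξ) * ((u (t + s) : ℝ) : ℂ) =
      Complex.exp (((s * ξ : ℝ) : ℂ) * Complex.I) *
        ∫ t : ℝ, Complex.exp (-Complex.I * t * ξ) * ((u t : ℝ) : ℂ) := by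
    rw [← integral_const_mul, ← integral_add_right_eq_self (fun t : ℝ =>
      Complex.exp (((s * ξ : ℝ) : ℂ) * Complex.I) *
        (Complex.exp (-Complex.I * t * ξ) * ((u t : ℝ) : ℂ))) s]
    congr 1
    ext t
    rw [← mul_assoc, ← Complex.exp_add]
    push_cast
    ring_nf
  have h2 : ∀ t : ℝ, Complex.exp (-Complex.I * t * ξ) * ((u (t + s) - u t : ℝ) : ℂ) =
      Complex.exp (-Complex.I * t * ξ) * ((u (t + s) : ℝ) : ℂ) -
        Complex.exp (-Complex.I * t * ξ) * ((u t : ℝ) : ℂ) := by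
    intro t
    push_cast
    ring
  simp only [fourierU, h2]
  rw [integral_sub (integrable_exp_mul (hu.comp_add_right s) ξ) (integrable_exp_mul hu ξ), h1]
  ring

end Fourier

/-! ### The stiffness matrix on the Fourier side. -/

namespace Mesh

variable {a b : ℝ} {N : ℕ} (M : Mesh a b N) (j k : Fin N) {α : ℝ}

/-- The hat is paired with the second derivative of the exponential. The right side is bounded in
`ξ`, which gives quadratic decay of the transform. -/
lemma sq_mul_fourierU_hat (ξ : ℝ) :
    -((ξ : ℂ) ^ 2) * fourierU (M.hat j) ξ = ((1 / √(2 * Real.pi) : ℝ) : ℂ) *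
      ∑ p, M.c j p • Complex.exp (-Complex.I * (M.nodes j p : ℂ) * ξ) := by
  have h1 : ∀ (z : ℂ) (t : ℝ), HasDerivAt
      (fun t : ℝ => z * Complex.exp (-Complex.I * t * ξ))
      (z * (-Complex.I * ξ) * Complex.exp (-Complex.I * t * ξ)) t := by
    intro z t
    convert! (((((Complex.ofRealCLM.hasDerivAt (x := t)).const_mul (-Complex.I)).mul_const
      (ξ : ℂ))).cexp).const_mul z using 1
    simp
    ring
  have h := integral_tent_smul_deriv2 (M.nodes_zero_lt_one j) (M.nodes_one_lt_two j)
    (h1 1) (h1 _) (by fun_prop)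
  rw [← M.sum_c_smul j, ← M.hat_eq_tent j] at h
  simp only [one_mul] at h
  rw [← h, fourierU, mul_left_comm, ← integral_const_mul]
  congr 2
  ext t
  rw [Complex.real_smul]
  linear_combination (-(ξ : ℂ) ^ 2 * M.hat j t * Complex.exp (-Complex.I * t * ξ)) * Complex.I_sq

lemma exists_norm_fourierU_hat_le :
    ∃ K, 0 ≤ K ∧ ∀ ξ : ℝ, ‖fourierU (M.hat j) ξ‖ ≤ K * (1 + ξ ^ 2)⁻¹ := by
  refine ⟨1 / √(2 * Real.pi) * (∫ t, ‖M.hat j t‖) + 1 / √(2 * Real.pi) * ∑ p, |M.c j p|,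
    by positivity, fun ξ => ?_⟩
  rw [← div_eq_mul_inv, le_div_iff₀ (by positivity), mul_add, mul_one]
  refine add_le_add (norm_fourierU_le _ _) ?_
  have h := congrArg norm (M.sq_mul_fourierU_hat j ξ)
  rw [norm_mul, norm_neg, norm_pow, Complex.norm_real, Real.norm_eq_abs, sq_abs, norm_mul,
    Complex.norm_real, Real.norm_of_nonneg (by positivity)] at h
  rw [mul_comm, h]
  refine mul_le_mul_of_nonneg_left ((norm_sum_le _ _).trans (Finset.sum_le_sum fun p _ => ?_))
    (by positivity)
  rw [norm_smul, norm_exp_neg_I_mul, mul_one, Real.norm_eq_abs]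

lemma integrable_fourierU_hatDiff (s : ℝ) : Integrable (fourierU (M.hatDiff j s)) := by
  obtain ⟨K, -, hK⟩ := M.exists_norm_fourierU_hat_le j
  refine ((integrable_inv_one_add_sq.const_mul K).const_mul 2).mono'
    (continuous_fourierU (M.integrable_hatDiff j s)).aestronglyMeasurable
    (Eventually.of_forall fun ξ => ?_)
  have e : fourierU (M.hatDiff j s) ξ = _ := fourierU_comp_add_sub (M.integrable_hat j) s ξ
  rw [e, norm_mul]
  refine mul_le_mul ?_ (hK ξ) (norm_nonneg _) zero_le_two
  refine (norm_sub_le _ _).trans ?_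
  rw [Complex.norm_exp_ofReal_mul_I, norm_one]
  norm_num

lemma integrable_symbolDensity (hα : α ∈ Ioo (0 : ℝ) 2) :
    Integrable (M.symbolDensity α j k) := by
  obtain ⟨K, hK0, hK⟩ := M.exists_norm_fourierU_hat_le j
  obtain ⟨K', hK0', hK'⟩ := M.exists_norm_fourierU_hat_le k
  have hm : Continuous (M.symbolDensity α j k) := by
    have h1 := continuous_fourierU (M.integrable_hat j)
    have h2 := continuous_fourierU (M.integrable_hat k)
    have h3 : Continuous fun ξ : ℝ => |ξ| ^ α :=
      continuous_abs.rpow_const fun _ => Or.inr hα.1.le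
    unfold symbolDensity
    exact ((Complex.continuous_ofReal.comp h3).mul h1).mul h2.star
  refine (integrable_inv_one_add_sq.const_mul (K * K')).mono' hm.aestronglyMeasurable
    (Eventually.of_forall fun ξ => ?_)
  -- Since `α < 2`, the symbol costs only one of the two factors `(1 + ξ²)⁻¹`.
  have h1 : |ξ| ^ α ≤ 1 + ξ ^ 2 := by
    rcases le_total |ξ| 1 with h | h
    · have := Real.rpow_le_one (abs_nonneg ξ) h hα.1.le
      nlinarith [sq_nonneg ξ]
    · have := Real.rpow_le_rpow_of_exponent_le h hα.2.le
      rw [Real.rpow_two, sq_abs] at this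
      linarith
  have hp : 0 < 1 + ξ ^ 2 := by positivity
  rw [symbolDensity, norm_mul, norm_mul, norm_star, Complex.norm_real,
    Real.norm_of_nonneg (by positivity)]
  calc |ξ| ^ α * ‖fourierU (M.hat j) ξ‖ * ‖fourierU (M.hat k) ξ‖
      ≤ (1 + ξ ^ 2) * (K * (1 + ξ ^ 2)⁻¹) * (K' * (1 + ξ ^ 2)⁻¹) := by
        gcongr
        · exact hK ξ
        · exact hK' ξ
    _ = K * K' * (1 + ξ ^ 2)⁻¹ := by field_simp

/-- An increment of step `s` multiplies the transform by `exp (isξ) - 1`, whose squared modulus is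
`2 (1 - cos sξ)`; Plancherel does the rest. -/
lemma integral_one_sub_cos_mul_fourierU (s : ℝ) :
    ∫ ξ, ((2 * (1 - Real.cos (s * ξ)) : ℝ) : ℂ) *
      (fourierU (M.hat j) ξ * star (fourierU (M.hat k) ξ)) = ((M.I s j k : ℝ) : ℂ) := by
  rw [← integral_hatDiff_mul, ← integral_fourierU_mul_star (M.integrable_hatDiff j s)
    (M.continuous_hatDiff j s) (M.integrable_fourierU_hatDiff j s) (M.integrable_hatDiff k s)]
  congr 1
  ext ξ
  have e : ∀ i, fourierU (M.hatDiff i s) ξ = _ := fun i =>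
    fourierU_comp_add_sub (M.integrable_hat i) s ξ
  rw [e, e, star_mul']
  have h : (Complex.exp (((s * ξ : ℝ) : ℂ) * Complex.I) - 1) *
      star (Complex.exp (((s * ξ : ℝ) : ℂ) * Complex.I) - 1) =
        ((2 * (1 - Real.cos (s * ξ)) : ℝ) : ℂ) := by
    rw [Complex.star_def, Complex.mul_conj, Complex.normSq_apply]
    congr 1
    simp only [Complex.sub_re, Complex.sub_im, Complex.exp_ofReal_mul_I_re,
      Complex.exp_ofReal_mul_I_im, Complex.one_re, Complex.one_im]
    linear_combination Real.sin_sq_add_cos_sq (s * ξ)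
  rw [← h]
  ring

lemma integral_symbolDensity (hα : α ∈ Ioo (0 : ℝ) 2) :
    ∫ ξ, M.symbolDensity α j k ξ = ((M.entry α j k : ℝ) : ℂ) := by
  have hW := (continuous_fourierU (M.integrable_hat j)).mul
    (continuous_fourierU (M.integrable_hat k)).star
  have hm : AEStronglyMeasurable (Function.uncurry fun ξ s : ℝ =>
      ((2 * (1 - Real.cos (s * ξ)) * rhoInf α s : ℝ) : ℂ) *
        (fourierU (M.hat j) ξ * star (fourierU (M.hat k) ξ)))
      (volume.prod (volume.restrict (Ioi 0))) := by
    have h1 := measurable_rhoInf α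
    have h2 : Measurable fun p : ℝ × ℝ => 2 * (1 - Real.cos (p.2 * p.1)) * rhoInf α p.2 := by
      fun_prop
    exact ((Complex.measurable_ofReal.comp h2).mul
      (hW.measurable.comp measurable_fst)).aestronglyMeasurable
  have hint : Integrable (Function.uncurry fun ξ s : ℝ =>
      ((2 * (1 - Real.cos (s * ξ)) * rhoInf α s : ℝ) : ℂ) *
        (fourierU (M.hat j) ξ * star (fourierU (M.hat k) ξ)))
      (volume.prod (volume.restrict (Ioi 0))) := by
    rw [integrable_prod_iff hm]
    refine ⟨Eventually.of_forall fun ξ =>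
      (integral_two_mul_one_sub_cos_mul_rhoInf hα ξ).1.ofReal.mul_const
        (fourierU (M.hat j) ξ * star (fourierU (M.hat k) ξ)), ?_⟩
    -- The weight in `s` is nonnegative, so integrating the norm over `s` gives exactly the norm of
    -- the symbol density.
    refine (M.integrable_symbolDensity j k hα).norm.congr (Eventually.of_forall fun ξ => ?_)
    simp only [Function.uncurry, symbolDensity]
    rw [mul_assoc, norm_mul, Complex.norm_real, Real.norm_of_nonneg (by positivity),
      ← (integral_two_mul_one_sub_cos_mul_rhoInf hα ξ).2, ← integral_mul_const]
    refine setIntegral_congr_fun measurableSet_Ioi fun s hs => ?_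
    have hs0 : (0 : ℝ) < s := hs
    have h1 := rhoInf_nonneg hα hs0.le
    have h2 := Real.cos_le_one (s * ξ)
    have h3 : 0 ≤ 2 * (1 - Real.cos (s * ξ)) * rhoInf α s := mul_nonneg (by linarith) h1
    rw [norm_mul (Complex.ofReal _), Complex.norm_real, Real.norm_of_nonneg h3, norm_mul]
  have hsw := integral_integral_swap hint
  have e1 : ∀ ξ, ∫ s in Ioi (0 : ℝ), ((2 * (1 - Real.cos (s * ξ)) * rhoInf α s : ℝ) : ℂ) *
      (fourierU (M.hat j) ξ * star (fourierU (M.hat k) ξ)) = M.symbolDensity α j k ξ := by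
    intro ξ
    rw [integral_mul_const, integral_complex_ofReal,
      (integral_two_mul_one_sub_cos_mul_rhoInf hα ξ).2, symbolDensity, mul_assoc]
  have e2 : ∀ s, ∫ ξ, ((2 * (1 - Real.cos (s * ξ)) * rhoInf α s : ℝ) : ℂ) *
      (fourierU (M.hat j) ξ * star (fourierU (M.hat k) ξ)) =
        ((M.I s j k * rhoInf α s : ℝ) : ℂ) := by
    intro s
    rw [Complex.ofReal_mul (M.I s j k), ← integral_one_sub_cos_mul_fourierU, ← integral_mul_const]
    congr 1
    ext ξ
    push_cast
    ring
  simp only [e1, e2] at hsw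
  rw [hsw, integral_complex_ofReal, M.integral_I_mul_rhoInf j k hα]

end Mesh

end NonlocalFEM

end

theorem theorem2p2 (a b : ℝ) (N : ℕ) (M : NonlocalFEM.Mesh a b N)
    (α : ℝ) (hα : α ∈ Set.Ioo (0 : ℝ) 2) (j k : Fin N) :
    -- the nonlocal stiffness matrices converge as the horizon tends to infinity
    Filter.Tendsto (fun δ : ℝ => M.stiffness (NonlocalFEM.rhoTrunc α δ) δ j k)
      Filter.atTop (nhds (M.entry α j k)) ∧
    -- the kernel integral with infinite horizon
    (MeasureTheory.IntegrableOn (fun s : ℝ => M.I s j k * NonlocalFEM.rhoInf α s) (Set.Ioi 0) ∧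
      ∫ s in Set.Ioi (0 : ℝ), M.I s j k * NonlocalFEM.rhoInf α s = M.entry α j k) ∧
    -- the stiffness matrix of the integral fractional Laplacian, by its energy form
    (MeasureTheory.Integrable (M.energyDensity α j k) ∧
      M.fracStiffness α j k = M.entry α j k) ∧
    -- the same matrix through the Fourier symbol
    (MeasureTheory.Integrable (M.symbolDensity α j k) ∧
      ∫ ξ : ℝ, M.symbolDensity α j k ξ = ((M.entry α j k : ℝ) : ℂ)) := by
  exact ⟨M.tendsto_stiffness j k hα,
    ⟨M.integrableOn_I_mul_rhoInf j k hα, M.integral_I_mul_rhoInf j k hα⟩,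
    ⟨M.integrable_energyDensity j k hα, M.fracStiffness_eq_entry j k hα⟩,
    ⟨M.integrable_symbolDensity j k hα, M.integral_symbolDensity j k hα⟩⟩
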